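/- **Setting.** Let $\Omega\subset\mathbb R^2$ be a bounded polygonal domain with Lipschitz boundary, $u(x_1,x_2)=x_1^2+x_2^2$, $\alpha\in[0,1]$ and $M>0$. Let $H\subset(0,\infty)$ (for instance $H=(0,h_0)$) and let $\{\mathcal T_h\}_{h\in H}$ be conforming triangulations of $\Omega$, where $h$ is the maximal diameter of the triangles of $\mathcal T_h$. Let $X_h$ be the space of continuous functions on $\overline\Omega$ that are affine on each triangle of $\mathcal T_h$, and let $|v|_1=(\int_\Omega|\nabla v|^2)^{1/2}$. Suppose that for every $h\in H$ there is $U_h\in X_h$ (e.g. the finite element solution) with $$|u-U_h|_1\le M h^\alpha .\tag{E}$$ A *band* $\mathcal B\subset\mathcal T_h$ consists of triangles $K_i=p_ip_{i+1}q_i$ ($0\le i\le N$) and $\tilde K_i=q_{i-1}q_ip_i$ ($1\le i\le N$) of $\mathcal T_h$, $N\ge1$, such that the segments $p_ip_{i+1}$, which are longest edges of the $K_i$, follow one another in one direction on a straight line, and the maximum angle $\tilde\alpha_i$ of $\tilde K_i$ is at $p_i$. Let $\alpha_i$ be the maximum angle of $K_i$ (it is at $q_i$), $|K|$ the area of $K$,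 and $L=|p_0-p_{N+1}|$ the length of the band. Bands are *disjoint* if they have no triangle in common; quantities of a band $\mathcal B_b$ carry the index $b$. **Statement.** There is $C_L>0$, depending only on $\Omega,\alpha,M$, such that the following holds. 1. For all $C_K,C_\alpha>0$ there is $C>0$, depending only on $\Omega,\alpha,M,C_K,C_\alpha$, such that for all families $\{\mathcal T_h\}_{h\in H}$ satisfying (E), all $h\in H$, and all finite families of disjoint bands $\mathcal B_1,\dots,\mathcal B_{N_{\mathcal B}}\subset\mathcal T_h$ with $$|\tilde K_i^b|\le C_K|K_i^b|,\quad |\tilde K_i^b|\le C_K|K_{i-1}^b|,\quad \sin(\pi-\alpha_{i-1}^b)\le C_\alpha\sin(\pi-\tilde\alpha_i^b)\quad(1\le i\le N_b)$$ and $L_b\ge C_Lh^{2\alpha/5}$ for all $b$, one has $$\Big(\sum_{b=1}^{N_{\mathcal B}}\min_{1\le i\le N_b}\frac1{\sin^2(\pi-\tilde\alpha_i^b)}\ \min_{1\le i\le N_b}|\tilde K_i^b|\ L_b^2N_b^{-1}\Big)^{1/2}\le C h^\alpha .$$ 2. (Babuška–Aziz-type meshes.) There is $c>0$, depending only on $\Omega,\alpha,M$,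 such that for all families satisfying (E) and all $h\in H$: if $\mathcal T_h$ contains $N_{\mathcal B}$ disjoint bands, all of length $L\ge C_Lh^{2\alpha/5}$ and consisting of identical isosceles triangles with base length $h$ and height $\bar h$, where $N_{\mathcal B}\bar h=L$, then $$\bar h\ge c\,h^{2-\alpha}L .$$ 3. (Babuška–Aziz-type meshes, lengths bounded below.) If $\alpha>0$ and $\ell>0$, there are $c,h_1>0$, depending only on $\Omega,\alpha,M,\ell$, such that for all families satisfying (E) and all $h\in H$ with $h<h_1$: if $\mathcal T_h$ contains bands as in part 2, but with $L\ge\ell$ in place of $L\ge C_Lh^{2\alpha/5}$, then $\bar h\ge c\,h^{2-\alpha}$. -/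

import Mathlib

noncomputable section

namespace BandFEM

/-- The Euclidean plane. -/
abbrev Plane : Type := EuclideanSpace ℝ (Fin 2)

/-- `Ω` is a bounded polygonal domain with Lipschitz boundary: a nonempty, open, connected, bounded
set whose boundary is a finite union of line segments and is locally, in suitable orthonormal
coordinates, the graph of a Lipschitz function with `Ω` lying on one side of that graph. -/
structure IsPolygonalLipschitzDomain (Ω : Set Plane) : Prop where
  isOpen : IsOpen Ω
  isConnected : IsConnected Ω
  isBounded : Bornology.IsBounded Ω
  polygonal : ∃ S : Finset (Plane × Plane), frontier Ω = ⋃ e ∈ S, segment ℝ e.1 e.2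
  lipschitz : ∀ x ∈ frontier Ω, ∃ (R : Plane ≃ₗᵢ[ℝ] Plane) (r : ℝ) (γ : ℝ → ℝ) (K : NNReal),
    0 < r ∧ LipschitzWith K γ ∧ ∀ y ∈ Metric.ball x r, y ∈ Ω ↔ γ (R y 0) < R y 1

/-- Conforming collections of simplices in the plane. Conformity (two simplices meet in the convex
hull of their common vertices) is part of Mathlib's notion of a simplicial complex. -/
abbrev Complex2 : Type := Geometry.SimplicialComplex ℝ Plane

/-- The vertex sets of the elements (triangles) of `𝒯`. -/
def elements (𝒯 : Complex2) : Set (Set Plane) :=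
  {T | ∃ s ∈ 𝒯.faces, s.card = 3 ∧ T = (s : Set Plane)}

/-- `𝒯` is a conforming triangulation of `Ω` into finitely many (closed, nondegenerate) triangles
whose maximal diameter is `h`. -/
structure IsTriangulation (Ω : Set Plane) (𝒯 : Complex2) (h : ℝ) : Prop where
  finite : 𝒯.faces.Finite
  pure : ∀ s ∈ 𝒯.faces, ∃ t ∈ 𝒯.faces, s ⊆ t ∧ t.card = 3
  space_eq : 𝒯.space = closure Ω
  meshSize : IsGreatest {d | ∃ T ∈ elements 𝒯, d = Metric.diam (convexHull ℝ T)} h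

/-- The piecewise linear finite element space `X_h`: functions that are continuous on the
triangulated set and affine on each triangle. The values off the triangulated set are irrelevant. -/
def feSpace (𝒯 : Complex2) : Set (Plane → ℝ) :=
  {U | ContinuousOn U 𝒯.space ∧
    ∀ T ∈ elements 𝒯, ∃ A : Plane →ᵃ[ℝ] ℝ, Set.EqOn U A (convexHull ℝ T)}

/-- The seminorm `|v|_{H¹(Ω)} = (∫_Ω |∇v|²)^{1/2}`. It is only used for the difference of a
polynomial and a continuous piecewise affine function, whose weak gradient is the classical
gradient, defined almost everywhere (the norm of the Fréchet derivative is that of the gradient). -/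
def h1Seminorm (Ω : Set Plane) (v : Plane → ℝ) : ℝ :=
  Real.sqrt (∫ x in Ω, ‖fderiv ℝ v x‖ ^ 2)

/-- The exact solution `u(x₁, x₂) = x₁² + x₂²`. -/
def quadFun (x : Plane) : ℝ := x 0 ^ 2 + x 1 ^ 2

/-- The error estimate `|u - U|_{H¹(Ω)} ≤ M h^α`, for all mesh sizes `h ∈ H`, where
`u = x₁² + x₂²` and `U = U h ∈ X_h` is some discrete function (for instance the finite element
solution) on the mesh `𝒯 h`. -/
def ErrorEstimate (Ω : Set Plane) (H : Set ℝ) (𝒯 : ℝ → Complex2) (α M : ℝ) : Prop :=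
  ∃ U : ℝ → Plane → ℝ, ∀ h ∈ H, U h ∈ feSpace (𝒯 h) ∧
    h1Seminorm Ω (fun x => quadFun x - U h x) ≤ M * h ^ α

/-- A family of triangulations of `Ω`, indexed by their mesh sizes `h ∈ H`, with `H ⊆ (0, ∞)`. -/
def IsTriangulationFamily (Ω : Set Plane) (H : Set ℝ) (𝒯 : ℝ → Complex2) : Prop :=
  ∀ h ∈ H, 0 < h ∧ IsTriangulation Ω (𝒯 h) h

/-- The maximum angle of the triangle `abc`. -/
def maxAngle (a b c : Plane) : ℝ :=
  max (EuclideanGeometry.angle b a c)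
    (max (EuclideanGeometry.angle a b c) (EuclideanGeometry.angle a c b))

/-- The area of the triangle `abc`. -/
def area (a b c : Plane) : ℝ :=
  MeasureTheory.volume.real (convexHull ℝ {a, b, c})

/-- A (straight) band in `𝒯`, consisting of the triangles
`K i = p i, p (i+1), q i` for `0 ≤ i ≤ N` and `K̃ (i+1) = q i, q (i+1), p (i+1)` for `0 ≤ i < N`,
with `N ≥ 1`. So consecutive triangles `K i, K̃ (i+1), K (i+1)` are neighbours through the edges
`q i, p (i+1)` and `p (i+1), q (i+1)`. The longest edges `p i, p (i+1)` of the triangles `K i` follow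
one another on a line, in the direction of the unit vector `g`, and form the edge `Γ` of the band.
The maximum angles alternate between the two sides of the band: that of `K i` is at `q i`
(opposite to its longest edge) and that of `K̃ (i+1)` is at `p (i+1)`, on `Γ`.
The values `p i` for `i > N + 1` and `q i` for `i > N` play no role. -/
structure Band (𝒯 : Complex2) where
  N : ℕ
  one_le_N : 1 ≤ N
  p : ℕ → Plane
  q : ℕ → Plane
  g : Plane
  norm_g : ‖g‖ = 1
  elem_mem : ∀ i ≤ N, {p i, p (i + 1), q i} ∈ elements 𝒯
  elem'_mem : ∀ i < N, {q i, q (i + 1), p (i + 1)} ∈ elements 𝒯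
  straight : ∀ i ≤ N, p (i + 1) = p i + dist (p i) (p (i + 1)) • g
  longest : ∀ i ≤ N, dist (p i) (q i) ≤ dist (p i) (p (i + 1)) ∧
    dist (p (i + 1)) (q i) ≤ dist (p i) (p (i + 1))
  maxAngle_eq' : ∀ i < N, EuclideanGeometry.angle (q i) (p (i + 1)) (q (i + 1)) =
    maxAngle (q i) (q (i + 1)) (p (i + 1))

namespace Band

variable {𝒯 : Complex2} (B : Band 𝒯)

/-- The set of (vertex sets of) all triangles of the band. -/
def elems : Set (Set Plane) :=
  {T | (∃ i ≤ B.N, T = {B.p i, B.p (i + 1), B.q i}) ∨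
    ∃ i < B.N, T = {B.q i, B.q (i + 1), B.p (i + 1)}}

/-- The length `L` of the band, that is, of its edge `Γ`. -/
def length : ℝ := dist (B.p 0) (B.p (B.N + 1))

/-- The maximum angle `α i` of `K i`, `0 ≤ i ≤ N`. -/
def ang (i : ℕ) : ℝ := maxAngle (B.p i) (B.p (i + 1)) (B.q i)

/-- The maximum angle of `K̃ (i+1)`, `0 ≤ i < N`. -/
def ang' (i : ℕ) : ℝ := maxAngle (B.q i) (B.q (i + 1)) (B.p (i + 1))

/-- The area of `K i`, `0 ≤ i ≤ N`. -/
def areaK (i : ℕ) : ℝ := area (B.p i) (B.p (i + 1)) (B.q i)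

/-- The area of `K̃ (i+1)`, `0 ≤ i < N`. -/
def areaK' (i : ℕ) : ℝ := area (B.q i) (B.q (i + 1)) (B.p (i + 1))

/-- The assumptions on the shape of neighbouring triangles of a band:
`|K̃ i| ≤ C_K |K i|`, `|K̃ i| ≤ C_K |K (i-1)|` and `sin (π - α (i-1)) ≤ C_α sin (π - α̃ i)` for
`i = 1, …, N`. -/
def IsAdmissible (C_K C_α : ℝ) : Prop :=
  ∀ i < B.N, B.areaK' i ≤ C_K * B.areaK (i + 1) ∧ B.areaK' i ≤ C_K * B.areaK i ∧
    Real.sin (Real.pi - B.ang i) ≤ C_α * Real.sin (Real.pi - B.ang' i)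

/-- The contribution `min_i sin⁻² (π - α̃ i) · min_i |K̃ i| · L² · N⁻¹` of one band. The two infima
are over the finite nonempty range `i = 1, …, N`, hence minima. -/
def weight : ℝ :=
  (⨅ i : Fin B.N, 1 / Real.sin (Real.pi - B.ang' i) ^ 2) * (⨅ i : Fin B.N, B.areaK' i) *
    B.length ^ 2 * (B.N : ℝ)⁻¹

end Band

/-- The bands of the family have no triangle in common. -/
def DisjointBands {𝒯 : Complex2} {n : ℕ} (B : Fin n → Band 𝒯) : Prop :=
  Pairwise fun b b' => Disjoint (B b).elems (B b').elems

/-- The triangle `abc` is isosceles with base `ab` of length `base` and with height `height`. -/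
def IsIsosceles (a b c : Plane) (base height : ℝ) : Prop :=
  dist a b = base ∧ dist a c = dist b c ∧ dist (midpoint ℝ a b) c = height

/-- A set of bands of Babuška–Aziz type: `n` disjoint bands of the same length `L` which consist of
identical isosceles triangles with base length `h` and height `hbar`, where `n * hbar = L`.
(This holds if the bands are stacked so as to fill the height `L`, as in the Babuška–Aziz mesh, but
the bands need not lie next to each other.) -/
structure IsBabuskaAziz {𝒯 : Complex2} {n : ℕ} (B : Fin n → Band 𝒯) (h hbar L : ℝ) : Prop where
  disjoint : DisjointBands B
  isosceles : ∀ b, ∀ i ≤ (B b).N, IsIsosceles ((B b).p i) ((B b).p (i + 1)) ((B b).q i) h hbar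
  isosceles' : ∀ b, ∀ i < (B b).N,
    IsIsosceles ((B b).q i) ((B b).q (i + 1)) ((B b).p (i + 1)) h hbar
  length_eq : ∀ b, (B b).length = L
  count : (n : ℝ) * hbar = L

end BandFEM

end

/-! The argument plays off two facts about a discrete function `U` along the edge `Γ` of a band.

Long bands force variation. On `Γ` the exact solution is `s²` plus an affine function of the arc
length `s`. If the slopes of `U` along `Γ` had total variation much smaller than the length, `U`
would be almost affine on an initial piece of `Γ` of length `ℓ` comparable to `L`. Testing `u - U`
against `ℓ² - 6ℓs + 6s²`, which is orthogonal to affine functions, then gives at least `ℓ⁵/60`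
(`le_integral_err`). The same integral is bounded by the energy error through Green's formula on a
parallelogram with one side on `Γ` (`abs_integral_err_le`); the Lipschitz boundary provides such a
parallelogram inside the closure of `Ω`, with angles bounded below (`exists_uniform_cone`). Hence
`ℓ⁴ ≤ C |u - U|₁² ≤ C M² h^(2α)`, which is false if `L ≥ C_L h^(2α/5)` with `C_L` large. So the
slope jumps add up to at least `c L` (`exists_le_sum_abs_jump`).

Flat triangles forbid large jumps. By continuity, the gradients on neighbouring triangles differ by
a vector orthogonal to their common edge. In a band these edges are nearly parallel to `Γ`, so the
slope jump across `K̃` is at most `sin (π - α̃)` times differences of gradients (`abs_jump_le`).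
Each gradient is compared with `∇u` at the vertex shared by the three triangles; the squared
difference times the area is bounded by the local energy error plus `8h²` times the area
(`area_mul_sq_le`).

Cauchy–Schwarz over the `N` jumps of a band, followed by summation over disjoint bands, gives the
first claim, since the triangles involved are essentially disjoint. For isosceles triangles the
weight of one band is at least a multiple of `h⁴ L / hbar`; with `n = L / hbar` bands the first
claim becomes the lower bound for `hbar`. If `L ≥ ℓ` and `α > 0`, the length condition holds for all
small `h`. -/

noncomputable section

namespace BandFEM

open MeasureTheory

/-! ### Angles and gradient jumps across edges -/

section Angles

variable {V : Type*} [NormedAddCommGroup V] [InnerProductSpace ℝ V]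

/-- The component of `g` orthogonal to `v` has norm `‖g‖ sin ∠(v, g)`. -/
lemma norm_sub_proj (v g : V) (hv : v ≠ 0) :
    ‖g - (inner ℝ v g / ‖v‖ ^ 2) • v‖ = ‖g‖ * Real.sin (InnerProductGeometry.angle v g) := by
  have hv' : 0 < ‖v‖ := norm_pos_iff.mpr hv
  have h := InnerProductGeometry.sin_angle_mul_norm_mul_norm v g
  have h1 : ‖g - (inner ℝ v g / ‖v‖ ^ 2) • v‖ * ‖v‖ =
      Real.sqrt (inner ℝ v v * inner ℝ g g - inner ℝ v g * inner ℝ v g) := by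
    have : ‖g - (inner ℝ v g / ‖v‖ ^ 2) • v‖ ^ 2 = ‖g‖ ^ 2 - (inner ℝ v g) ^ 2 / ‖v‖ ^ 2 := by
      rw [norm_sub_sq_real, inner_smul_right, norm_smul, real_inner_comm, mul_pow,
        Real.norm_eq_abs, sq_abs]
      field_simp
      ring
    rw [← Real.sqrt_sq (by positivity : 0 ≤ ‖g - (inner ℝ v g / ‖v‖ ^ 2) • v‖ * ‖v‖), mul_pow,
      this, real_inner_self_eq_norm_sq, real_inner_self_eq_norm_sq]
    congr 1
    field_simp
  rw [← h] at h1
  have := mul_right_cancel₀ hv'.ne' (h1.trans (by ring :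
    _ = (‖g‖ * Real.sin (InnerProductGeometry.angle v g)) * ‖v‖))
  exact this

/-- As `z` is orthogonal to `v`, it only sees the component of `g` orthogonal to `v`. -/
lemma abs_inner_le_sin_angle {z v : V} (g : V) (hv : v ≠ 0) (hz : inner ℝ z v = 0) :
    |inner ℝ z g| ≤ ‖z‖ * (‖g‖ * Real.sin (InnerProductGeometry.angle v g)) := by
  rw [← norm_sub_proj v g hv]
  have : inner ℝ z g = inner ℝ z (g - (inner ℝ v g / ‖v‖ ^ 2) • v) := by
    rw [inner_sub_right, inner_smul_right, hz]; ring
  rw [this]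
  exact abs_real_inner_le_norm _ _

/-- Passing from `v'` to `g` by way of `v` costs the sum of the two sines: split `g` into a multiple
of `v` and an orthogonal remainder. Thus the second edge of `K̃` at its obtuse vertex is compared
with `Γ` through the first one, and no assumption on the angle of the second neighbour is needed. -/
lemma abs_inner_le_sin_angle_add {z v v' : V} (g : V) (hv : v ≠ 0) (hv' : v' ≠ 0)
    (hz : inner ℝ z v' = 0) :
    |inner ℝ z g| ≤ ‖z‖ * (‖g‖ * (Real.sin (InnerProductGeometry.angle v' v) +
      Real.sin (InnerProductGeometry.angle v g))) := by
  have hvn : 0 < ‖v‖ := norm_pos_iff.mpr hv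
  set c := inner ℝ v g / ‖v‖ ^ 2 with hc
  have h1 : inner ℝ z g = inner ℝ z (g - c • v) + c * inner ℝ z v := by
    rw [inner_sub_right, inner_smul_right]; ring
  have h2 : |c| * ‖v‖ ≤ ‖g‖ := by
    rw [hc, abs_div, abs_of_pos (by positivity : 0 < ‖v‖ ^ 2), div_mul_eq_mul_div,
      div_le_iff₀ (by positivity)]
    nlinarith [abs_real_inner_le_norm v g]
  have h3 := abs_inner_le_sin_angle v hv' hz
  have h4 := abs_real_inner_le_norm z (g - c • v)
  rw [hc, norm_sub_proj v g hv, ← hc] at h4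
  have hs := InnerProductGeometry.sin_angle_nonneg v' v
  calc |inner ℝ z g| ≤ |inner ℝ z (g - c • v)| + |c| * |inner ℝ z v| := by
        rw [h1, ← abs_mul]; exact abs_add_le _ _
    _ ≤ ‖z‖ * (‖g‖ * Real.sin (InnerProductGeometry.angle v g)) +
        |c| * (‖z‖ * (‖v‖ * Real.sin (InnerProductGeometry.angle v' v))) := by gcongr
    _ = ‖z‖ * (‖g‖ * Real.sin (InnerProductGeometry.angle v g)) +
        (|c| * ‖v‖) * (‖z‖ * Real.sin (InnerProductGeometry.angle v' v)) := by ring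
    _ ≤ ‖z‖ * (‖g‖ * Real.sin (InnerProductGeometry.angle v g)) +
        ‖g‖ * (‖z‖ * Real.sin (InnerProductGeometry.angle v' v)) := by gcongr
    _ = _ := by ring

end Angles

/-- Meant for two angles of a triangle, `m` being the largest, so that `x + m ≤ π`; the sine
increases up to `π / 2` and is symmetric about it. -/
lemma sin_le_sin_of_le_of_le_pi_sub {x m : ℝ} (h0 : 0 ≤ x) (h1 : x ≤ m) (h2 : m ≤ Real.pi - x) :
    Real.sin x ≤ Real.sin m := by
  rcases le_total m (Real.pi / 2) with h | h
  · exact Real.sin_le_sin_of_le_of_le_pi_div_two (by linarith [Real.pi_pos]) h h1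
  · rw [← Real.sin_pi_sub m]
    exact Real.sin_le_sin_of_le_of_le_pi_div_two (by linarith [Real.pi_pos]) (by linarith)
      (by linarith)

/-- The sine of an angle of a triangle is at most the sine of the maximum angle. -/
lemma sin_angle_le_sin_maxAngle {a b c : Plane} (hab : a ≠ b) :
    Real.sin (EuclideanGeometry.angle a b c) ≤ Real.sin (maxAngle a b c) := by
  have hsum := EuclideanGeometry.angle_add_angle_add_angle_eq_pi c hab.symm
  have h1 := EuclideanGeometry.angle_nonneg a b c
  have h2 := EuclideanGeometry.angle_nonneg b c a
  have h3 := EuclideanGeometry.angle_nonneg c a b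
  have e2 := EuclideanGeometry.angle_comm b c a
  have e3 := EuclideanGeometry.angle_comm c a b
  have hm1 : EuclideanGeometry.angle a b c ≤ maxAngle a b c :=
    (le_max_left _ _).trans (le_max_right _ _)
  unfold maxAngle at *
  rcases max_choice (EuclideanGeometry.angle b a c)
    (max (EuclideanGeometry.angle a b c) (EuclideanGeometry.angle a c b)) with h | h
  · exact sin_le_sin_of_le_of_le_pi_sub h1 hm1 (by rw [h]; linarith)
  · rcases max_choice (EuclideanGeometry.angle a b c) (EuclideanGeometry.angle a c b) with h' | h'
    · rw [h, h']
    · exact sin_le_sin_of_le_of_le_pi_sub h1 hm1 (by rw [h, h']; linarith)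

/-- If the gradients `w₀, w, w₁` of a continuous piecewise linear function on three successive
triangles of a band are compatible across the common edges, then the jump of the derivative in
the direction of the band is controlled by the sine of the maximum angle. -/
lemma abs_jump_le {p₀ p q₀ q₁ g w₀ w w₁ : Plane} {S Cα : ℝ} (hg : ‖g‖ = 1)
    (hp : p₀ ≠ p) (hpg : p = p₀ + dist p₀ p • g) (hq₀ : q₀ ≠ p) (hq₁ : q₁ ≠ p)
    (h₀ : inner ℝ (w - w₀) (q₀ - p) = 0) (h₁ : inner ℝ (w - w₁) (q₁ - p) = 0)
    (hS : Real.sin (EuclideanGeometry.angle q₀ p q₁) = S)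
    (hα : Real.sin (EuclideanGeometry.angle p₀ p q₀) ≤ Cα * S) :
    |inner ℝ (w₁ - w₀) g| ≤ S * (Cα * ‖w - w₀‖ + (1 + Cα) * ‖w - w₁‖) := by
  have hd : 0 < dist p₀ p := dist_pos.mpr hp
  have hneg : p₀ - p = (-dist p₀ p) • g := by
    rw [neg_smul, eq_neg_iff_add_eq_zero, sub_add_eq_add_sub, ← hpg, sub_self]
  have hang : Real.sin (InnerProductGeometry.angle (q₀ - p) g) =
      Real.sin (EuclideanGeometry.angle p₀ p q₀) := by
    unfold EuclideanGeometry.angle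
    rw [vsub_eq_sub, vsub_eq_sub, hneg,
      InnerProductGeometry.angle_smul_left_of_neg _ _ (neg_neg_of_pos hd),
      InnerProductGeometry.angle_neg_left, Real.sin_pi_sub, InnerProductGeometry.angle_comm]
  have hang' : Real.sin (InnerProductGeometry.angle (q₁ - p) (q₀ - p)) = S := by
    rw [InnerProductGeometry.angle_comm, ← hS]; rfl
  have k₀ := abs_inner_le_sin_angle g (sub_ne_zero.mpr hq₀) h₀
  have k₁ := abs_inner_le_sin_angle_add g (sub_ne_zero.mpr hq₀) (sub_ne_zero.mpr hq₁) h₁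
  rw [hg, one_mul, hang] at k₀
  rw [hg, one_mul, hang, hang'] at k₁
  have e : inner ℝ (w₁ - w₀) g = inner ℝ (w - w₀) g - inner ℝ (w - w₁) g := by
    rw [← inner_sub_left]; congr 1; abel
  rw [e]
  calc _ ≤ |inner ℝ (w - w₀) g| + |inner ℝ (w - w₁) g| := abs_sub _ _
    _ ≤ ‖w - w₀‖ * (Cα * S) + ‖w - w₁‖ * (S + Cα * S) := by
      refine add_le_add (k₀.trans ?_) (k₁.trans ?_) <;> gcongr
    _ = _ := by ring

/-! ### Elements as essentially disjoint pieces of the domain; local gradient errors -/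

section Triangulation

lemma volume_convexHull_of_collinear {s : Set Plane} (hs : Collinear ℝ s) :
    volume (convexHull ℝ s) = 0 := by
  refine measure_mono_null (convexHull_subset_affineSpan s) ?_
  refine Measure.addHaar_affineSubspace _ _ fun htop => ?_
  have h1 := collinear_iff_finrank_le_one.mp hs
  rw [← direction_affineSpan, htop, AffineSubspace.direction_top, finrank_top] at h1
  simp at h1

lemma volume_frontier_eq_zero {Ω : Set Plane} (hΩ : IsPolygonalLipschitzDomain Ω) :
    volume (frontier Ω) = 0 := by
  obtain ⟨S, hS⟩ := hΩ.polygonal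
  rw [hS]
  refine (measure_biUnion_null_iff S.countable_toSet).mpr fun e _ => ?_
  rw [← convexHull_pair]
  exact volume_convexHull_of_collinear (collinear_pair ℝ _ _)

/-- The error is an integral over `Ω`, but the closed triangles fill its closure; the boundary, a
finite union of segments, is negligible. -/
lemma ae_eq_closure {Ω : Set Plane} (hΩ : IsPolygonalLipschitzDomain Ω) :
    Ω =ᵐ[volume] closure Ω := by
  refine (LE.le.eventuallyLE subset_closure).antisymm ?_
  rw [ae_le_set]
  refine measure_mono_null ?_ (volume_frontier_eq_zero hΩ)
  rw [frontier, hΩ.isOpen.interior_eq]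

variable {𝒯 : Complex2} {Ω : Set Plane} {h : ℝ}

lemma elements_subset_space {T : Set Plane} (hT : T ∈ elements 𝒯) :
    convexHull ℝ T ⊆ 𝒯.space := by
  obtain ⟨s, hs, -, rfl⟩ := hT
  exact Geometry.SimplicialComplex.convexHull_subset_space hs

lemma finite_of_mem_elements {T : Set Plane} (hT : T ∈ elements 𝒯) : T.Finite := by
  obtain ⟨s, -, -, rfl⟩ := hT
  exact s.finite_toSet

lemma isCompact_convexHull_element {T : Set Plane} (hT : T ∈ elements 𝒯) :
    IsCompact (convexHull ℝ T) :=
  (finite_of_mem_elements hT).isCompact_convexHull ℝ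

lemma IsTriangulation.finite_elements (h𝒯 : IsTriangulation Ω 𝒯 h) : (elements 𝒯).Finite := by
  refine (h𝒯.finite.image (fun s : Finset Plane => (s : Set Plane))).subset ?_
  rintro T ⟨s, hs, -, rfl⟩
  exact ⟨s, hs, rfl⟩

lemma IsTriangulation.closure_eq (h𝒯 : IsTriangulation Ω 𝒯 h) :
    closure Ω = ⋃ T ∈ elements 𝒯, convexHull ℝ T := by
  rw [← h𝒯.space_eq]
  refine Set.Subset.antisymm (fun x hx => ?_) (Set.iUnion₂_subset fun T hT =>
    elements_subset_space hT)
  obtain ⟨s, hs, hxs⟩ := Geometry.SimplicialComplex.mem_space_iff.mp hx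
  obtain ⟨t, ht, hst, hc⟩ := h𝒯.pure s hs
  exact Set.mem_biUnion ⟨t, ht, hc, rfl⟩ (convexHull_mono (by exact_mod_cast hst) hxs)

lemma element_notMem_affineSpan {T : Set Plane} (hT : T ∈ elements 𝒯) {x : Plane} (hx : x ∈ T) :
    x ∉ affineSpan ℝ (T \ {x}) := by
  obtain ⟨s, hs, -, rfl⟩ := hT
  have := (𝒯.indep hs).notMem_affineSpan_sdiff ⟨x, hx⟩ Set.univ
  have he : (Subtype.val : s → Plane) '' (Set.univ \ {⟨x, hx⟩}) = (s : Set Plane) \ {x} := by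
    ext y
    simp only [Set.mem_sdiff, Finset.mem_coe, Set.mem_singleton_iff, Set.mem_image, Set.mem_univ,
      true_and, Subtype.exists, Subtype.mk.injEq, exists_and_left, exists_prop,
      exists_eq_right_right]
    tauto
  rwa [he] at this

/-- By conformity the intersection lies in the hull of the common vertices. Some vertex `x` of `T`
is not among them, so the intersection lies in the span of the other vertices of `T`, a proper
affine subspace by affine independence. -/
lemma aedisjoint_elements {T T' : Set Plane} (hT : T ∈ elements 𝒯) (hT' : T' ∈ elements 𝒯)
    (hne : T ≠ T') : AEDisjoint volume (convexHull ℝ T) (convexHull ℝ T') := by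
  have hx : ∃ x ∈ T, x ∉ T' := by
    by_contra! hsub
    obtain ⟨s, hs, hsc, rfl⟩ := hT
    obtain ⟨t, ht, htc, rfl⟩ := hT'
    exact hne (congrArg _ (Finset.eq_of_subset_of_card_le (fun x hx => hsub x hx)
      (by rw [hsc, htc])))
  obtain ⟨x, hxT, hxT'⟩ := hx
  have hnot := element_notMem_affineSpan hT hxT
  have hsub : convexHull ℝ T ∩ convexHull ℝ T' ⊆ affineSpan ℝ (T \ {x}) := by
    obtain ⟨s, hs, hsc, rfl⟩ := hT
    obtain ⟨t, ht, htc, rfl⟩ := hT'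
    refine (𝒯.inter_subset_convexHull hs ht).trans ((convexHull_mono ?_).trans
      (convexHull_subset_affineSpan _))
    rintro y ⟨hy, hy'⟩
    exact ⟨hy, fun hyx => hxT' (hyx ▸ hy')⟩
  refine measure_mono_null hsub (Measure.addHaar_affineSubspace _ _ fun htop => hnot ?_)
  rw [htop]; exact AffineSubspace.mem_top ℝ _ x

/-- Sums of integrals over distinct elements are bounded by the integral over the domain. -/
lemma sum_setIntegral_le {ι : Type*} [Fintype ι] (hΩ : IsPolygonalLipschitzDomain Ω)
    (h𝒯 : IsTriangulation Ω 𝒯 h) {T : ι → Set Plane} (hT : ∀ i, T i ∈ elements 𝒯)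
    (hinj : Function.Injective T) {f : Plane → ℝ} (hf : IntegrableOn f Ω) (hf0 : ∀ x, 0 ≤ f x) :
    ∑ i, ∫ x in convexHull ℝ (T i), f x ≤ ∫ x in Ω, f x := by
  have hfc : IntegrableOn f (closure Ω) := hf.congr_set_ae (ae_eq_closure hΩ).symm
  have hsub : ⋃ i, convexHull ℝ (T i) ⊆ closure Ω := by
    rw [← h𝒯.space_eq]
    exact Set.iUnion_subset fun i => elements_subset_space (hT i)
  rw [setIntegral_congr_set (ae_eq_closure hΩ), ← tsum_fintype (L := .unconditional _),
    ← integral_iUnion_ae (fun i => (isCompact_convexHull_element (hT i)).measurableSet.nullMeasurableSet)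
      (fun i j hij => aedisjoint_elements (hT i) (hT j) (hinj.ne hij)) (hfc.mono_set hsub)]
  exact setIntegral_mono_set hfc (Filter.Eventually.of_forall hf0)
    (LE.le.eventuallyLE hsub)

/-- `w` is the gradient of `U` on the (closed) triangle with vertex set `T`. -/
def IsGradOn (U : Plane → ℝ) (T : Set Plane) (w : Plane) : Prop :=
  ∀ x ∈ convexHull ℝ T, ∀ y ∈ convexHull ℝ T, U x - U y = inner ℝ w (x - y)

lemma exists_isGradOn {U : Plane → ℝ} (hU : U ∈ feSpace 𝒯) {T : Set Plane}
    (hT : T ∈ elements 𝒯) : ∃ w, IsGradOn U T w := by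
  obtain ⟨A, hA⟩ := hU.2 T hT
  refine ⟨(InnerProductSpace.toDual ℝ Plane).symm A.linear.toContinuousLinearMap,
    fun x hx y hy => ?_⟩
  rw [InnerProductSpace.toDual_symm_apply, hA hx, hA hy]
  simpa using (A.linearMap_vsub x y).symm

/-- The error `u - U` for the quadratic `u = x₁² + x₂²`. -/
def err (U : Plane → ℝ) (x : Plane) : ℝ := quadFun x - U x

lemma quadFun_eq (x : Plane) : quadFun x = ‖x‖ ^ 2 := by
  rw [EuclideanSpace.real_norm_sq_eq, Fin.sum_univ_two]; rfl

lemma IsGradOn.hasFDerivAt_err {U : Plane → ℝ} {T : Set Plane} {w x : Plane}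
    (hw : IsGradOn U T w) (hx : x ∈ interior (convexHull ℝ T)) :
    HasFDerivAt (err U) (innerSL ℝ ((2 : ℝ) • x - w)) x := by
  have h1 : HasFDerivAt (fun y : Plane => ‖y‖ ^ 2 - (U x + innerSL ℝ w (y - x)))
      (innerSL ℝ ((2 : ℝ) • x - w)) x := by
    have ha := (hasStrictFDerivAt_norm_sq x).hasFDerivAt
    have hb : HasFDerivAt (fun y => innerSL ℝ w (y - x)) (innerSL ℝ w) x :=
      (innerSL ℝ w).hasFDerivAt.comp x ((hasFDerivAt_id x).sub_const x)
    have hc := ha.sub (hb.const_add (U x))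
    have hd : innerSL ℝ ((2 : ℝ) • x - w) = 2 • innerSL ℝ x - innerSL ℝ w := by
      ext v
      simp
    rw [hd]
    exact hc
  refine h1.congr_of_eventuallyEq ?_
  filter_upwards [isOpen_interior.mem_nhds hx] with y hy
  have := hw y (interior_subset hy) x (interior_subset hx)
  simp only [err, quadFun_eq, innerSL_apply_apply]
  linarith

lemma IsGradOn.norm_fderiv_err {U : Plane → ℝ} {T : Set Plane} {w x : Plane}
    (hw : IsGradOn U T w) (hx : x ∈ interior (convexHull ℝ T)) :
    ‖fderiv ℝ (err U) x‖ = ‖(2 : ℝ) • x - w‖ := by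
  rw [(hw.hasFDerivAt_err hx).fderiv, innerSL_apply_norm]

lemma volume_frontier_convexHull (T : Set Plane) : volume (frontier (convexHull ℝ T)) = 0 :=
  (convex_convexHull ℝ T).addHaar_frontier volume

/-- There are finitely many triangles, and on each the gradient of the error is `2x - w` with `w`
constant. -/
lemma exists_norm_fderiv_err_le (h𝒯 : IsTriangulation Ω 𝒯 h) {U : Plane → ℝ}
    (hU : U ∈ feSpace 𝒯) :
    ∃ b, ∀ T ∈ elements 𝒯, ∀ x ∈ interior (convexHull ℝ T), ‖fderiv ℝ (err U) x‖ ≤ b := by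
  have key : ∀ T ∈ elements 𝒯, ∃ b, ∀ x ∈ interior (convexHull ℝ T),
      ‖fderiv ℝ (err U) x‖ ≤ b := by
    intro T hT
    obtain ⟨w, hw⟩ := exists_isGradOn hU hT
    obtain ⟨R, hR⟩ := (isCompact_convexHull_element hT).isBounded.exists_norm_le
    refine ⟨2 * R + ‖w‖, fun x hx => ?_⟩
    rw [hw.norm_fderiv_err hx]
    refine (norm_sub_le _ _).trans ?_
    rw [norm_smul, Real.norm_ofNat]
    gcongr
    exact hR x (interior_subset hx)
  choose! b hb using key
  obtain ⟨c, hc⟩ := (h𝒯.finite_elements.image b).bddAbove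
  exact ⟨c, fun T hT x hx => (hb T hT x hx).trans (hc ⟨T, hT, rfl⟩)⟩

/-- Almost all points of the closure of the domain are interior to an element. -/
lemma ae_mem_interior_element (h𝒯 : IsTriangulation Ω 𝒯 h) :
    ∀ᵐ x, x ∈ closure Ω → ∃ T ∈ elements 𝒯, x ∈ interior (convexHull ℝ T) := by
  have : ∀ᵐ x, ∀ T ∈ elements 𝒯, x ∉ frontier (convexHull ℝ T) :=
    (ae_ball_iff h𝒯.finite_elements.countable).mpr fun T _ =>
      measure_eq_zero_iff_ae_notMem.mp (volume_frontier_convexHull T)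
  filter_upwards [this] with x hx hxΩ
  rw [h𝒯.closure_eq] at hxΩ
  obtain ⟨T, hT, hxT⟩ := Set.mem_iUnion₂.mp hxΩ
  refine ⟨T, hT, by_contra fun hni => hx T hT ⟨subset_closure hxT, hni⟩⟩

lemma measurable_fderiv_err (U : Plane → ℝ) : Measurable (fun x => fderiv ℝ (err U) x) :=
  measurable_fderiv ℝ _

/-- Indispensable for the meaning of the error estimate: without integrability the integral would
have the default value `0`. -/
lemma integrableOn_sq_norm_fderiv_err (hΩ : IsPolygonalLipschitzDomain Ω)
    (h𝒯 : IsTriangulation Ω 𝒯 h) {U : Plane → ℝ} (hU : U ∈ feSpace 𝒯) :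
    IntegrableOn (fun x => ‖fderiv ℝ (err U) x‖ ^ 2) (closure Ω) := by
  obtain ⟨b, hb⟩ := exists_norm_fderiv_err_le h𝒯 hU
  refine IntegrableOn.of_bound (hΩ.isBounded.closure.measure_lt_top)
    (((measurable_fderiv_err U).norm.pow_const 2).aestronglyMeasurable) (b ^ 2) ?_
  rw [ae_restrict_iff' isClosed_closure.measurableSet]
  filter_upwards [ae_mem_interior_element h𝒯] with x hx hxΩ
  obtain ⟨T, hT, hxT⟩ := hx hxΩ
  rw [Real.norm_of_nonneg (by positivity)]
  gcongr
  exact hb T hT x hxT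

lemma diam_element_le (h𝒯 : IsTriangulation Ω 𝒯 h) {T : Set Plane} (hT : T ∈ elements 𝒯)
    {x y : Plane} (hx : x ∈ convexHull ℝ T) (hy : y ∈ convexHull ℝ T) : dist x y ≤ h :=
  (Metric.dist_le_diam_of_mem (isCompact_convexHull_element hT).isBounded hx hy).trans
    (h𝒯.meshSize.2 ⟨T, hT, rfl⟩)

/-- The gradient of `U` on an element is close to that of `u` at any point of the element, up to
the error on the element. -/
lemma area_mul_sq_le (hΩ : IsPolygonalLipschitzDomain Ω)
    (h𝒯 : IsTriangulation Ω 𝒯 h) {U : Plane → ℝ} (hU : U ∈ feSpace 𝒯) {T : Set Plane}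
    (hT : T ∈ elements 𝒯) {w p : Plane} (hw : IsGradOn U T w) (hp : p ∈ T) :
    volume.real (convexHull ℝ T) * ‖w - (2 : ℝ) • p‖ ^ 2 ≤
      ∫ x in convexHull ℝ T, (2 * ‖fderiv ℝ (err U) x‖ ^ 2 + 8 * h ^ 2) := by
  have hc := isCompact_convexHull_element hT
  have hsub : convexHull ℝ T ⊆ closure Ω := h𝒯.space_eq ▸ elements_subset_space hT
  have hint := (integrableOn_sq_norm_fderiv_err hΩ h𝒯 hU).mono_set hsub
  rw [← smul_eq_mul, ← setIntegral_const]
  refine setIntegral_mono_on_ae (integrableOn_const hc.measure_lt_top.ne) ((hint.const_mul 2).add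
    (integrableOn_const hc.measure_lt_top.ne)) hc.measurableSet ?_
  filter_upwards [measure_eq_zero_iff_ae_notMem.mp (volume_frontier_convexHull T)] with x hx hxT
  have hxi : x ∈ interior (convexHull ℝ T) :=
    by_contra fun hni => hx ⟨subset_closure hxT, hni⟩
  rw [hw.norm_fderiv_err hxi]
  have hd := diam_element_le h𝒯 hT hxT (subset_convexHull ℝ T hp)
  rw [dist_eq_norm] at hd
  have h1 : ‖w - (2 : ℝ) • p‖ ≤ ‖(2 : ℝ) • x - w‖ + 2 * ‖x - p‖ := by
    calc ‖w - (2 : ℝ) • p‖ = ‖-((2 : ℝ) • x - w) + (2 : ℝ) • (x - p)‖ := by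
          congr 1; module
      _ ≤ _ := by
          refine (norm_add_le _ _).trans ?_
          rw [norm_neg, norm_smul, Real.norm_ofNat]
  have h0 := norm_nonneg (x - p)
  have h2 := norm_nonneg ((2 : ℝ) • x - w)
  have h3 := norm_nonneg (w - (2 : ℝ) • p)
  have h4 : ‖x - p‖ ^ 2 ≤ h ^ 2 := by gcongr
  -- This is `(a + 2b)² ≤ 2a² + 8b²`, the source of the constants 2 and 8.
  nlinarith [sq_nonneg (‖(2 : ℝ) • x - w‖ - 2 * ‖x - p‖)]

end Triangulation

/-! ### A uniform interior cone condition transversal to a given direction -/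

section Cone

/-- The cross product of two vectors in the plane. -/
def cross (x y : Plane) : ℝ := x 0 * y 1 - x 1 * y 0

lemma cross_sq (x y : Plane) : cross x y ^ 2 = ‖x‖ ^ 2 * ‖y‖ ^ 2 - inner ℝ x y ^ 2 := by
  rw [EuclideanSpace.real_norm_sq_eq, EuclideanSpace.real_norm_sq_eq, PiLp.inner_apply]
  simp only [Fin.sum_univ_two, cross, RCLike.inner_apply, conj_trivial]
  ring

/-- The square is used because an isometry may be a reflection, which changes the sign of the cross
product. -/
lemma cross_map_sq (R : Plane ≃ₗᵢ[ℝ] Plane) (x y : Plane) :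
    cross (R x) (R y) ^ 2 = cross x y ^ 2 := by
  simp [cross_sq]

lemma le_graph_of_mem_closure {Ω : Set Plane} {x y : Plane} {R : Plane ≃ₗᵢ[ℝ] Plane} {r : ℝ}
    {γ : ℝ → ℝ} (hγ : Continuous γ) (hx : ∀ y ∈ Metric.ball x r, y ∈ Ω ↔ γ (R y 0) < R y 1)
    (hy : y ∈ closure Ω) (hyx : y ∈ Metric.ball x r) : γ (R y 0) ≤ R y 1 := by
  by_contra! hlt
  have hopen : IsOpen {z : Plane | R z 1 < γ (R z 0)} :=
    isOpen_lt (by fun_prop) (by fun_prop)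
  obtain ⟨z, ⟨hz1, hz2⟩, hzΩ⟩ :=
    mem_closure_iff.mp hy _ (hopen.inter Metric.isOpen_ball) ⟨hlt, hyx⟩
  exact absurd ((hx z hz2).mp hzΩ) (not_lt.mpr (le_of_lt hz1))

/-- A direction steeper than the Lipschitz constant outruns the graph, and does so strictly even
when starting on it. -/
lemma add_mem_of_cone {Ω : Set Plane} {x y v : Plane} {R : Plane ≃ₗᵢ[ℝ] Plane} {r t : ℝ}
    {γ : ℝ → ℝ} {K : NNReal} (hγ : LipschitzWith K γ)
    (hx : ∀ y ∈ Metric.ball x r, y ∈ Ω ↔ γ (R y 0) < R y 1) (hy : y ∈ closure Ω)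
    (hyx : y ∈ Metric.ball x r) (ht : 0 < t) (hyt : y + t • R.symm v ∈ Metric.ball x r)
    (hv : K * |v 0| < v 1) : y + t • R.symm v ∈ Ω := by
  rw [hx _ hyt]
  have h1 := le_graph_of_mem_closure hγ.continuous hx hy hyx
  have h2 := hγ.dist_le_mul (R y 0 + t * v 0) (R y 0)
  rw [Real.dist_eq, Real.dist_eq, add_sub_cancel_left, abs_mul, abs_of_pos ht] at h2
  have h3 := le_abs_self (γ (R y 0 + t * v 0) - γ (R y 0))
  simp only [map_add, map_smul, LinearIsometryEquiv.apply_symm_apply, PiLp.add_apply,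
    PiLp.smul_apply, smul_eq_mul]
  nlinarith

lemma norm_le_one_of_sq {v : Plane} (hv : v 0 ^ 2 + v 1 ^ 2 ≤ 1) : ‖v‖ ≤ 1 := by
  have : ‖v‖ ^ 2 ≤ 1 := by rwa [EuclideanSpace.real_norm_sq_eq, Fin.sum_univ_two]
  nlinarith [norm_nonneg v]

/-- Among two fixed directions in the cone of aperture `1 / K`, one is transversal to `u`. -/
lemma exists_transversal (K : NNReal) {u : Plane} (hu : ‖u‖ = 1) :
    ∃ v : Plane, ‖v‖ ≤ 1 ∧ K * |v 0| < v 1 ∧ (1 / (2 * ((K : ℝ) + 2))) ^ 2 ≤ cross u v ^ 2 := by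
  have hK : (0 : ℝ) ≤ K := K.2
  have hu2 : u 0 ^ 2 + u 1 ^ 2 = 1 := by
    have := EuclideanSpace.real_norm_sq_eq u
    rw [hu, Fin.sum_univ_two] at this
    linarith
  by_cases h : 1 / (2 * ((K : ℝ) + 2)) ≤ |u 0|
  · refine ⟨!₂[0, 1], norm_le_one_of_sq (by simp), by simp, ?_⟩
    have : cross u !₂[0, 1] = u 0 := by simp [cross]
    rw [this, ← sq_abs (u 0)]
    gcongr
  -- If `u` is nearly vertical, tilt the vertical direction slightly. As `|u 0| + |u 1| ≥ 1`, the
  -- numerator of the cross product is at least `1 - (K + 2)|u 0| > 1/2`.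
  · push Not at h
    rw [lt_div_iff₀ (by positivity)] at h
    refine ⟨!₂[1 / ((K : ℝ) + 2), (K + 1) / ((K : ℝ) + 2)], norm_le_one_of_sq ?_, ?_, ?_⟩
    · simp only [Matrix.cons_val_zero, Matrix.cons_val_one]
      rw [div_pow, div_pow, ← add_div, div_le_one (by positivity)]
      nlinarith
    · simp only [Matrix.cons_val_zero, Matrix.cons_val_one]
      rw [abs_of_pos (by positivity), mul_one_div]
      gcongr
      linarith
    · have : cross u !₂[1 / ((K : ℝ) + 2), (K + 1) / ((K : ℝ) + 2)] =
          (u 0 * (K + 1) - u 1) / (K + 2) := by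
        simp only [cross, Matrix.cons_val_zero, Matrix.cons_val_one]
        ring
      rw [this, ← sq_abs ((u 0 * (K + 1) - u 1) / (K + 2))]
      gcongr
      rw [abs_div, abs_of_pos (by positivity : (0 : ℝ) < K + 2),
        div_le_div_iff₀ (by positivity) (by positivity)]
      have h1 : 1 ≤ |u 0| + |u 1| := by
        have := sq_abs (u 0)
        have := sq_abs (u 1)
        nlinarith [abs_nonneg (u 0), abs_nonneg (u 1)]
      have h2 : |u 1| - |u 0| * (K + 1) ≤ |u 0 * (K + 1) - u 1| := by
        have := abs_sub_abs_le_abs_sub (u 1) (u 0 * (K + 1))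
        rwa [abs_mul, abs_of_pos (by positivity : (0 : ℝ) < K + 1), abs_sub_comm] at this
      nlinarith

/-- A uniform cone property: from all points of the closure close to `x`, one can go into the
domain in one direction `d` which is transversal to the given direction `g`. -/
lemma exists_uniform_cone {Ω : Set Plane} (hΩ : IsPolygonalLipschitzDomain Ω) :
    ∃ ρ κ : ℝ, 0 < ρ ∧ 0 < κ ∧ ∀ x ∈ closure Ω, ∀ g : Plane, ‖g‖ = 1 → ∃ d : Plane, ‖d‖ ≤ 1 ∧
      κ ≤ cross g d ^ 2 ∧ ∀ y ∈ closure Ω, dist y x < ρ → ∀ t, 0 < t → t < ρ → y + t • d ∈ Ω := by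
  have hball : ∀ {x z y d : Plane} {r t : ℝ}, z ∈ Metric.ball x (r / 3) → dist y z < r / 3 →
      ‖d‖ ≤ 1 → 0 < t → t < r / 3 → y ∈ Metric.ball x r ∧ y + t • d ∈ Metric.ball x r := by
    intro x z y d r t hz hy hd ht htr
    rw [Metric.mem_ball] at hz
    have h1 : dist (y + t • d) y ≤ t := by
      rw [dist_eq_norm, add_sub_cancel_left, norm_smul, Real.norm_of_nonneg ht.le]
      nlinarith
    have h2 := dist_triangle y z x
    have h3 := dist_triangle (y + t • d) y x
    exact ⟨by rw [Metric.mem_ball]; linarith [dist_nonneg (x := y) (y := z)],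
      by rw [Metric.mem_ball]; linarith⟩
  have hcomp : IsCompact (closure Ω) := hΩ.isBounded.isCompact_closure
  -- Compactness makes `ρ` and `κ` uniform. Locally, the radius `r` is shared in thirds by the base
  -- point, the distance of `y` from it and the step `t • d`.
  refine hcomp.induction_on (p := fun s => ∃ ρ κ : ℝ, 0 < ρ ∧ 0 < κ ∧ ∀ x ∈ s, ∀ g : Plane,
    ‖g‖ = 1 → ∃ d : Plane, ‖d‖ ≤ 1 ∧ κ ≤ cross g d ^ 2 ∧ ∀ y ∈ closure Ω, dist y x < ρ →
      ∀ t, 0 < t → t < ρ → y + t • d ∈ Ω) ?_ ?_ ?_ ?_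
  · exact ⟨1, 1, one_pos, one_pos, fun x hx => absurd hx (Set.notMem_empty x)⟩
  · rintro s t hst ⟨ρ, κ, hρ, hκ, H⟩
    exact ⟨ρ, κ, hρ, hκ, fun x hx => H x (hst hx)⟩
  · rintro s s' ⟨ρ, κ, hρ, hκ, H⟩ ⟨ρ', κ', hρ', hκ', H'⟩
    refine ⟨min ρ ρ', min κ κ', lt_min hρ hρ', lt_min hκ hκ', ?_⟩
    rintro x (hx | hx) g hg
    · obtain ⟨d, h1, h2, h3⟩ := H x hx g hg
      exact ⟨d, h1, (min_le_left _ _).trans h2, fun y hy hyx t ht htρ =>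
        h3 y hy (hyx.trans_le (min_le_left _ _)) t ht (htρ.trans_le (min_le_left _ _))⟩
    · obtain ⟨d, h1, h2, h3⟩ := H' x hx g hg
      exact ⟨d, h1, (min_le_right _ _).trans h2, fun y hy hyx t ht htρ =>
        h3 y hy (hyx.trans_le (min_le_right _ _)) t ht (htρ.trans_le (min_le_right _ _))⟩
  · intro x hx
    by_cases hxΩ : x ∈ Ω
    · obtain ⟨r, hr, hrΩ⟩ := Metric.isOpen_iff.mp hΩ.isOpen x hxΩ
      refine ⟨Metric.ball x (r / 3), mem_nhdsWithin_of_mem_nhds (Metric.ball_mem_nhds x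
        (by positivity)), r / 3, 1, by positivity, one_pos, fun z hz g hg => ?_⟩
      have hg2 : g 0 ^ 2 + g 1 ^ 2 = 1 := by
        have := EuclideanSpace.real_norm_sq_eq g
        rw [hg, Fin.sum_univ_two] at this
        linarith
      have hd : ‖(!₂[-g 1, g 0] : Plane)‖ ≤ 1 := by
        refine norm_le_one_of_sq ?_
        simp only [Matrix.cons_val_zero, Matrix.cons_val_one]
        linarith
      refine ⟨!₂[-g 1, g 0], hd, ?_, fun y _ hyz t ht htr => hrΩ (hball hz hyz hd ht htr).2⟩
      have : cross g !₂[-g 1, g 0] = 1 := by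
        simp only [cross, Matrix.cons_val_zero, Matrix.cons_val_one]
        linarith
      rw [this]; norm_num
    · have hxf : x ∈ frontier Ω := ⟨hx, by rwa [hΩ.isOpen.interior_eq]⟩
      obtain ⟨R, r, γ, K, hr, hγ, hR⟩ := hΩ.lipschitz x hxf
      have hK : (0 : ℝ) ≤ K := K.2
      refine ⟨Metric.ball x (r / 3), mem_nhdsWithin_of_mem_nhds (Metric.ball_mem_nhds x
        (by positivity)), r / 3, (1 / (2 * ((K : ℝ) + 2))) ^ 2, by positivity, by positivity,
        fun z hz g hg => ?_⟩
      obtain ⟨v, hv1, hv2, hv3⟩ := exists_transversal K (u := R g) (by simpa using hg)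
      have hd : ‖R.symm v‖ ≤ 1 := by simpa using hv1
      refine ⟨R.symm v, hd, ?_, fun y hy hyz t ht htr => ?_⟩
      · rwa [← cross_map_sq R, LinearIsometryEquiv.apply_symm_apply]
      · obtain ⟨h1, h2⟩ := hball hz hyz hd ht htr
        exact add_mem_of_cone hγ hR hy h1 ht h2 hv2

end Cone

/-! ### Green's formula in oblique coordinates and differentiability along almost every line -/

section Trace

lemma integral_deriv_mul {ℓ : ℝ} (hℓ : 0 ≤ ℓ) {f f' χ χ' : ℝ → ℝ} {S : Set ℝ}
    (hS : S.Countable) (hf : ContinuousOn f (Set.Icc 0 ℓ))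
    (hd : ∀ t ∈ Set.Ioo 0 ℓ \ S, HasDerivAt f (f' t) t) (hi : IntegrableOn f' (Set.Icc 0 ℓ))
    (hχ : ∀ t, HasDerivAt χ (χ' t) t) (hχ' : Continuous χ') :
    ∫ t in Set.Icc 0 ℓ, (f' t * χ t + f t * χ' t) = f ℓ * χ ℓ - f 0 * χ 0 := by
  have hχc : Continuous χ := continuous_iff_continuousAt.mpr fun t => (hχ t).continuousAt
  rw [integral_Icc_eq_integral_Ioc, ← intervalIntegral.integral_of_le hℓ]
  refine integral_eq_of_hasDerivAt_off_countable (fun t => f t * χ t) _ hS ?_ ?_ ?_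
  · rw [Set.uIcc_of_le hℓ]
    exact hf.mul hχc.continuousOn
  · rw [min_eq_left hℓ, max_eq_right hℓ]
    exact fun t ht => (hd t ht).mul (hχ t)
  · rw [intervalIntegrable_iff_integrableOn_Icc_of_le hℓ]
    exact (hi.mul_continuousOn hχc.continuousOn isCompact_Icc).add
      ((hf.mul hχ'.continuousOn).integrableOn_compact isCompact_Icc)

/-- Green's formula on a square, for a continuous function `F` whose restriction to almost every
line is differentiable off a countable set. -/
lemma green_square {ℓ : ℝ} (hℓ : 0 ≤ ℓ) {F G₁ G₂ : ℝ × ℝ → ℝ} {φ φ' χ χ' : ℝ → ℝ}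
    (hF : ContinuousOn F (Set.Icc 0 ℓ ×ˢ Set.Icc 0 ℓ))
    (hG₁ : IntegrableOn G₁ (Set.Icc 0 ℓ ×ˢ Set.Icc 0 ℓ))
    (hG₂ : IntegrableOn G₂ (Set.Icc 0 ℓ ×ˢ Set.Icc 0 ℓ))
    (h₁ : ∀ᵐ t : ℝ, t ∈ Set.Icc 0 ℓ → ∃ S : Set ℝ, S.Countable ∧ ∀ s ∈ Set.Ioo 0 ℓ \ S,
      HasDerivAt (fun s => F (s, t)) (G₁ (s, t)) s)
    (h₂ : ∀ᵐ s : ℝ, s ∈ Set.Icc 0 ℓ → ∃ S : Set ℝ, S.Countable ∧ ∀ t ∈ Set.Ioo 0 ℓ \ S,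
      HasDerivAt (fun t => F (s, t)) (G₂ (s, t)) t)
    (hφ : ∀ t, HasDerivAt φ (φ' t) t) (hφ' : Continuous φ')
    (hχ : ∀ t, HasDerivAt χ (χ' t) t) (hχ' : Continuous χ')
    (hφ0 : φ 0 = 0) (hφℓ : φ ℓ = 0) (hχ0 : χ 0 = 1) (hχℓ : χ ℓ = 0) :
    ∫ s in Set.Icc 0 ℓ, F (s, 0) * φ' s =
      ∫ z in Set.Icc 0 ℓ ×ˢ Set.Icc 0 ℓ, (G₁ z * (φ z.1 * χ' z.2) - G₂ z * (φ' z.1 * χ z.2)) := by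
  set Q : Set (ℝ × ℝ) := Set.Icc 0 ℓ ×ˢ Set.Icc 0 ℓ with hQ
  have hQc : IsCompact Q := isCompact_Icc.prod isCompact_Icc
  have hφc : Continuous φ := continuous_iff_continuousAt.mpr fun t => (hφ t).continuousAt
  have hχc : Continuous χ := continuous_iff_continuousAt.mpr fun t => (hχ t).continuousAt
  have hi₁ : IntegrableOn (fun z : ℝ × ℝ => (G₁ z * φ z.1 + F z * φ' z.1) * χ' z.2) Q := by
    refine ((hG₁.mul_continuousOn (hφc.comp continuous_fst).continuousOn hQc).add
      ((hF.mul (hφ'.comp continuous_fst).continuousOn).integrableOn_compact hQc)).mul_continuousOn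
      (hχ'.comp continuous_snd).continuousOn hQc
  have hi₂ : IntegrableOn (fun z : ℝ × ℝ => (G₂ z * χ z.2 + F z * χ' z.2) * φ' z.1) Q := by
    refine ((hG₂.mul_continuousOn (hχc.comp continuous_snd).continuousOn hQc).add
      ((hF.mul (hχ'.comp continuous_snd).continuousOn).integrableOn_compact hQc)).mul_continuousOn
      (hφ'.comp continuous_fst).continuousOn hQc
  have hprod : (volume : Measure (ℝ × ℝ)) = (volume : Measure ℝ).prod volume := rfl
  have hI₁ : ∫ z in Q, (G₁ z * φ z.1 + F z * φ' z.1) * χ' z.2 = 0 := by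
    have hr : ∀ᵐ t ∂volume.restrict (Set.Icc (0 : ℝ) ℓ),
        IntegrableOn (fun s => G₁ (s, t)) (Set.Icc 0 ℓ) := by
      have := hG₁
      rw [IntegrableOn, hQ, hprod, ← Measure.prod_restrict] at this
      exact this.prod_left_ae
    rw [ae_restrict_iff' measurableSet_Icc] at hr
    have hi := hi₁
    rw [IntegrableOn, hQ, hprod, ← Measure.prod_restrict] at hi
    rw [hQ, hprod, ← Measure.prod_restrict, integral_prod_symm _ hi]
    refine (setIntegral_congr_ae (g := 0) measurableSet_Icc ?_).trans (integral_zero' _ _)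
    filter_upwards [h₁, hr] with t ht hrt htI
    obtain ⟨S, hS, hd⟩ := ht htI
    have hc : ContinuousOn (fun s => F (s, t)) (Set.Icc 0 ℓ) :=
      hF.comp (by fun_prop) fun s hs => ⟨hs, htI⟩
    have := integral_deriv_mul hℓ hS hc hd (hrt htI) hφ hφ'
    rw [hφ0, hφℓ, mul_zero, mul_zero, sub_zero] at this
    simp only [integral_mul_const, this, zero_mul, Pi.zero_apply]
  have hI₂ : ∫ z in Q, (G₂ z * χ z.2 + F z * χ' z.2) * φ' z.1 =
      -∫ s in Set.Icc 0 ℓ, F (s, 0) * φ' s := by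
    have hr : ∀ᵐ s ∂volume.restrict (Set.Icc (0 : ℝ) ℓ),
        IntegrableOn (fun t => G₂ (s, t)) (Set.Icc 0 ℓ) := by
      have := hG₂
      rw [IntegrableOn, hQ, hprod, ← Measure.prod_restrict] at this
      exact this.prod_right_ae
    rw [ae_restrict_iff' measurableSet_Icc] at hr
    have hi := hi₂
    rw [IntegrableOn, hQ, hprod, ← Measure.prod_restrict] at hi
    rw [hQ, hprod, ← Measure.prod_restrict, integral_prod _ hi, ← integral_neg]
    refine setIntegral_congr_ae measurableSet_Icc ?_
    filter_upwards [h₂, hr] with s hs hrs hsI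
    obtain ⟨S, hS, hd⟩ := hs hsI
    have hc : ContinuousOn (fun t => F (s, t)) (Set.Icc 0 ℓ) :=
      hF.comp (by fun_prop) fun t ht => ⟨hsI, ht⟩
    have := integral_deriv_mul hℓ hS hc hd (hrs hsI) hχ hχ'
    rw [hχ0, hχℓ, mul_zero, mul_one, zero_sub] at this
    simp only [integral_mul_const, this, neg_mul]
  -- In the difference of the two line-by-line identities the terms `F φ' χ'` cancel, so only
  -- derivatives of `F` remain.
  calc _ = (∫ z in Q, (G₁ z * φ z.1 + F z * φ' z.1) * χ' z.2) -
        ∫ z in Q, (G₂ z * χ z.2 + F z * χ' z.2) * φ' z.1 := by rw [hI₁, hI₂]; ring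
    _ = _ := by
      rw [← integral_sub hi₁ hi₂]
      congr 1
      ext z
      ring

/-- The parametrization of a parallelogram. -/
def param (a g d : Plane) (z : ℝ × ℝ) : Plane := a + z.1 • g + z.2 • d

lemma continuous_param (a g d : Plane) : Continuous (param a g d) := by
  unfold param; fun_prop

lemma map_param (a : Plane) {g d : Plane} (hgd : cross g d ≠ 0) :
    Measure.map (param a g d) volume = ENNReal.ofReal |(cross g d)⁻¹| • volume := by
  let A : Matrix (Fin 2) (Fin 2) ℝ := !![g 0, d 0; g 1, d 1]
  have hA : A.det = cross g d := by
    simp only [A, Matrix.det_fin_two_of, cross]; ring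
  have h1 : Measure.map (MeasurableEquiv.finTwoArrow (α := ℝ)).symm volume = volume :=
    (volume_preserving_finTwoArrow ℝ).symm.map_eq
  have h2 : Measure.map (Matrix.toLin' A) volume = ENNReal.ofReal |A.det⁻¹| • volume :=
    Real.map_matrix_volume_pi_eq_smul_volume_pi (by rwa [hA])
  have h3 : Measure.map (WithLp.toLp 2 : (Fin 2 → ℝ) → Plane) volume = volume :=
    (PiLp.volume_preserving_toLp (Fin 2)).map_eq
  have h4 : Measure.map (fun x : Plane => a + x) volume = volume :=
    (measurePreserving_add_left volume a).map_eq
  have hm2 : Measurable (Matrix.toLin' A) :=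
    (LinearMap.continuous_of_finiteDimensional _).measurable
  have hm3 : Measurable (WithLp.toLp 2 : (Fin 2 → ℝ) → Plane) :=
    (PiLp.volume_preserving_toLp (Fin 2)).measurable
  have hm4 : Measurable (fun x : Plane => a + x) := measurable_const_add a
  have hcomp : param a g d = (fun x : Plane => a + x) ∘ (WithLp.toLp 2 : (Fin 2 → ℝ) → Plane) ∘
      (Matrix.toLin' A) ∘ (MeasurableEquiv.finTwoArrow (α := ℝ)).symm := by
    funext z
    ext i
    fin_cases i <;>
    simp [param, A, MeasurableEquiv.finTwoArrow] <;>
    ring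
  rw [hcomp, ← Measure.map_map hm4 (hm3.comp (hm2.comp (MeasurableEquiv.measurable _))),
    ← Measure.map_map hm3 (hm2.comp (MeasurableEquiv.measurable _)),
    ← Measure.map_map hm2 (MeasurableEquiv.measurable _), h1, h2, hA, Measure.map_smul,
    Measure.map_smul, h3, h4]

lemma ae_param (a : Plane) {g d : Plane} (hgd : cross g d ≠ 0) {P : Plane → Prop}
    (hP : ∀ᵐ x, P x) : ∀ᵐ z, P (param a g d z) := by
  refine ae_of_ae_map (continuous_param a g d).aemeasurable ?_
  rw [map_param a hgd]
  exact Measure.ae_smul_measure hP _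

/-- A line through the interior meets the frontier at most once on each side of an interior point. A
line missing the interior meets `C` in an interval of frontier points, which is null by assumption
and so has at most one point. The assumption excludes lines running along an edge. -/
lemma finite_line_frontier {C : Set Plane} (hC : Convex ℝ C) (hcl : IsClosed C) (x v : Plane)
    (h0 : volume {t : ℝ | x + t • v ∈ frontier C} = 0) :
    {t : ℝ | x + t • v ∈ frontier C}.Finite := by
  have hseg : ∀ r s t : ℝ, r < s → s < t →
      x + s • v ∈ openSegment ℝ (x + r • v) (x + t • v) := by
    intro r s t hrs hst
    refine ⟨(t - s) / (t - r), (s - r) / (t - r), div_pos (by linarith) (by linarith),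
      div_pos (by linarith) (by linarith), ?_, ?_⟩
    · rw [← add_div, sub_add_sub_cancel, div_self (by linarith)]
    · have : t - r ≠ 0 := by linarith
      rw [smul_add, smul_add, smul_smul, smul_smul, add_add_add_comm, ← add_smul, ← add_smul,
        ← add_div, sub_add_sub_cancel, div_self this, one_smul]
      congr 2
      field_simp
      ring
  have hsub : frontier C ⊆ C := hcl.frontier_subset
  by_cases hint : ∃ t₀ : ℝ, x + t₀ • v ∈ interior C
  · obtain ⟨t₀, ht₀⟩ := hint
    have hl : ({t : ℝ | x + t • v ∈ frontier C} ∩ Set.Iio t₀).Subsingleton := by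
      suffices H : ∀ r s : ℝ, x + r • v ∈ frontier C → x + s • v ∈ frontier C → r < s →
          s < t₀ → False by
        rintro r ⟨hr, hr'⟩ s ⟨hs, hs'⟩
        rcases lt_trichotomy r s with h | h | h
        · exact (H r s hr hs h hs').elim
        · exact h
        · exact (H s r hs hr h hr').elim
      intro r s hr hs hrs hst
      exact hs.2 (hC.openSegment_self_interior_subset_interior (hsub hr) ht₀ (hseg r s t₀ hrs hst))
    have hr : ({t : ℝ | x + t • v ∈ frontier C} ∩ Set.Ioi t₀).Subsingleton := by
      suffices H : ∀ r s : ℝ, x + r • v ∈ frontier C → x + s • v ∈ frontier C → r < s →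
          t₀ < r → False by
        rintro r ⟨hr, hr'⟩ s ⟨hs, hs'⟩
        rcases lt_trichotomy r s with h | h | h
        · exact (H r s hr hs h hr').elim
        · exact h
        · exact (H s r hs hr h hs').elim
      intro r s hr hs hrs hst
      exact hr.2 (hC.openSegment_interior_self_subset_interior ht₀ (hsub hs) (hseg t₀ r s hst hrs))
    refine (hl.finite.union hr.finite).subset fun t ht => ?_
    rcases lt_trichotomy t t₀ with h | h | h
    · exact Or.inl ⟨ht, h⟩
    · exact absurd (h ▸ ht₀) ht.2
    · exact Or.inr ⟨ht, h⟩
  · push Not at hint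
    refine Set.Subsingleton.finite ?_
    suffices H : ∀ r s : ℝ, x + r • v ∈ frontier C → x + s • v ∈ frontier C → r < s → False by
      intro r hr s hs
      rcases lt_trichotomy r s with h | h | h
      · exact (H r s hr hs h).elim
      · exact h
      · exact (H s r hs hr h).elim
    intro r s hr hs hrs
    have : Set.Ioo r s ⊆ {t : ℝ | x + t • v ∈ frontier C} := fun t ht =>
      ⟨subset_closure (hC.openSegment_subset (hsub hr) (hsub hs) (hseg r t s ht.1 ht.2)), hint t⟩
    have h1 := measure_mono_null this h0
    rw [Real.volume_Ioo, ENNReal.ofReal_eq_zero] at h1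
    linarith

variable {𝒯 : Complex2} {Ω : Set Plane} {h : ℝ}

/-- By Fubini, almost every line of a parallel family meets the null set of triangle boundaries in a
null set of parameters. -/
lemma ae_finite_line_frontier (h𝒯 : IsTriangulation Ω 𝒯 h) (a : Plane) {g d : Plane}
    (hgd : cross g d ≠ 0) : ∀ᵐ s : ℝ, ∀ T ∈ elements 𝒯,
      {t : ℝ | a + s • g + t • d ∈ frontier (convexHull ℝ T)}.Finite := by
  refine (ae_ball_iff h𝒯.finite_elements.countable).mpr fun T hT => ?_
  have h1 := ae_param a hgd (measure_eq_zero_iff_ae_notMem.mp (volume_frontier_convexHull T))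
  have h2 : ∀ᵐ s : ℝ, ∀ᵐ t : ℝ, param a g d (s, t) ∉ frontier (convexHull ℝ T) :=
    Measure.ae_ae_of_ae_prod h1
  filter_upwards [h2] with s hs
  exact finite_line_frontier (convex_convexHull ℝ T) (isCompact_convexHull_element hT).isClosed _ _
    (measure_eq_zero_iff_ae_notMem.mpr hs)

lemma exists_hasDerivAt_err_line (h𝒯 : IsTriangulation Ω 𝒯 h) {U : Plane → ℝ}
    (hU : U ∈ feSpace 𝒯) {x v : Plane} {ℓ : ℝ}
    (hfin : ∀ T ∈ elements 𝒯, {t : ℝ | x + t • v ∈ frontier (convexHull ℝ T)}.Finite)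
    (hmem : ∀ t ∈ Set.Icc 0 ℓ, x + t • v ∈ closure Ω) :
    ∃ S : Set ℝ, S.Countable ∧ ∀ t ∈ Set.Ioo 0 ℓ \ S,
      HasDerivAt (fun t : ℝ => err U (x + t • v)) (fderiv ℝ (err U) (x + t • v) v) t := by
  refine ⟨⋃ T ∈ elements 𝒯, {t : ℝ | x + t • v ∈ frontier (convexHull ℝ T)},
    h𝒯.finite_elements.countable.biUnion fun T hT => (hfin T hT).countable, ?_⟩
  rintro t ⟨ht, htS⟩
  have hx := hmem t (Set.Ioo_subset_Icc_self ht)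
  rw [h𝒯.closure_eq] at hx
  obtain ⟨T, hT, hxT⟩ := Set.mem_iUnion₂.mp hx
  have hxi : x + t • v ∈ interior (convexHull ℝ T) := by
    by_contra hni
    exact htS (Set.mem_biUnion hT ⟨subset_closure hxT, hni⟩)
  obtain ⟨w, hw⟩ := exists_isGradOn hU hT
  have h1 := (hw.hasFDerivAt_err hxi).differentiableAt.hasFDerivAt
  have h2 : HasDerivAt (fun t : ℝ => x + t • v) v t := by
    simpa using ((hasDerivAt_id t).smul_const v).const_add x
  exact h1.comp_hasDerivAt t h2

lemma continuousOn_err (h𝒯 : IsTriangulation Ω 𝒯 h) {U : Plane → ℝ} (hU : U ∈ feSpace 𝒯) :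
    ContinuousOn (err U) (closure Ω) := by
  have h1 : Continuous quadFun := by unfold quadFun; fun_prop
  exact h1.continuousOn.sub (h𝒯.space_eq ▸ hU.1)

end Trace

/-! ### The trace estimate and its conflict with almost linear `U` -/

section TraceEstimate

variable {𝒯 : Complex2} {Ω : Set Plane} {h : ℝ}

lemma integrableOn_param (a : Plane) {g d : Plane} (hgd : cross g d ≠ 0) {Q : Set (ℝ × ℝ)}
    (hQ : ∀ z ∈ Q, param a g d z ∈ closure Ω) {f : Plane → ℝ} (hfm : Measurable f)
    (hf : IntegrableOn f (closure Ω)) (hf0 : ∀ x, 0 ≤ f x) :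
    IntegrableOn (fun z => f (param a g d z)) Q ∧
      ∫ z in Q, f (param a g d z) ≤ |(cross g d)⁻¹| * ∫ x in closure Ω, f x := by
  have hpm := (continuous_param a g d).measurable
  have hcl : MeasurableSet (closure Ω) := isClosed_closure.measurableSet
  have h1 : IntegrableOn f (closure Ω) (Measure.map (param a g d) volume) := by
    rw [map_param a hgd, IntegrableOn, Measure.restrict_smul]
    exact hf.smul_measure ENNReal.ofReal_ne_top
  have h2 : IntegrableOn (fun z => f (param a g d z)) (param a g d ⁻¹' closure Ω) := by
    rw [IntegrableOn, Measure.restrict_map hpm hcl] at h1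
    exact (integrable_map_measure hfm.aestronglyMeasurable hpm.aemeasurable).mp h1
  refine ⟨h2.mono_set hQ, ?_⟩
  calc _ ≤ ∫ z in param a g d ⁻¹' closure Ω, f (param a g d z) :=
        setIntegral_mono_set h2 (Filter.Eventually.of_forall fun z => hf0 _)
          (LE.le.eventuallyLE hQ)
    _ = _ := by
        rw [← setIntegral_map hcl hfm.aestronglyMeasurable hpm.aemeasurable, map_param a hgd,
          Measure.restrict_smul, integral_smul_measure, ENNReal.toReal_ofReal (abs_nonneg _),
          smul_eq_mul]

/-- Both weights are at most `ℓ²`, and `2N ≤ c + N²/c`. The parameter `c` stays free so that its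
term can later be absorbed. -/
lemma abs_green_integrand_le {ℓ c s t x y N : ℝ} (hℓ : 0 < ℓ) (hc : 0 < c)
    (hs : s ∈ Set.Icc 0 ℓ) (ht : t ∈ Set.Icc 0 ℓ) (hx : |x| ≤ N) (hy : |y| ≤ N) :
    |x * ((ℓ ^ 2 * s - 3 * ℓ * s ^ 2 + 2 * s ^ 3) * -(1 / ℓ)) -
      y * ((ℓ ^ 2 - 6 * ℓ * s + 6 * s ^ 2) * (1 - t / ℓ))| ≤ c * ℓ ^ 2 + ℓ ^ 2 / c * N ^ 2 := by
  obtain ⟨hs0, hs1⟩ := hs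
  obtain ⟨ht0, ht1⟩ := ht
  have hN0 : 0 ≤ N := (abs_nonneg _).trans hx
  have k3 : |(ℓ ^ 2 * s - 3 * ℓ * s ^ 2 + 2 * s ^ 3) * -(1 / ℓ)| ≤ ℓ ^ 2 := by
    have : (ℓ ^ 2 * s - 3 * ℓ * s ^ 2 + 2 * s ^ 3) * -(1 / ℓ) =
        -(s * (ℓ - s) * (ℓ - 2 * s)) / ℓ := by field_simp; ring
    rw [this, abs_div, abs_neg, abs_of_pos hℓ, div_le_iff₀ hℓ, abs_mul,
      abs_of_nonneg (mul_nonneg hs0 (sub_nonneg.mpr hs1))]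
    have e1 : s * (ℓ - s) ≤ ℓ ^ 2 := by nlinarith
    have e2 : |ℓ - 2 * s| ≤ ℓ := abs_le.mpr ⟨by linarith, by linarith⟩
    gcongr
  have k4 : |(ℓ ^ 2 - 6 * ℓ * s + 6 * s ^ 2) * (1 - t / ℓ)| ≤ ℓ ^ 2 := by
    have e1 : |ℓ ^ 2 - 6 * ℓ * s + 6 * s ^ 2| ≤ ℓ ^ 2 :=
      abs_le.mpr ⟨by nlinarith [sq_nonneg (ℓ - 2 * s)], by nlinarith⟩
    have e2 : |1 - t / ℓ| ≤ 1 := by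
      have u1 : t / ℓ ≤ 1 := (div_le_one hℓ).mpr ht1
      have u2 : 0 ≤ t / ℓ := by positivity
      exact abs_le.mpr ⟨by linarith, by linarith⟩
    rw [abs_mul]
    calc _ ≤ ℓ ^ 2 * 1 := by gcongr
      _ = _ := mul_one _
  calc _ ≤ |x| *
        |(ℓ ^ 2 * s - 3 * ℓ * s ^ 2 + 2 * s ^ 3) * -(1 / ℓ)| +
        |y| *
        |(ℓ ^ 2 - 6 * ℓ * s + 6 * s ^ 2) * (1 - t / ℓ)| := by
        rw [← abs_mul, ← abs_mul]; exact abs_sub _ _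
    _ ≤ N * ℓ ^ 2 + N * ℓ ^ 2 := by gcongr
    _ = ℓ ^ 2 * (2 * N) := by ring
    _ ≤ ℓ ^ 2 * (c + N ^ 2 / c) := by
        gcongr
        have : 2 * N ≤ (c ^ 2 + N ^ 2) / c := by
          rw [le_div_iff₀ hc]; nlinarith [sq_nonneg (c - N)]
        calc _ ≤ _ := this
          _ = _ := by field_simp
    _ = _ := by ring

set_option maxHeartbeats 1000000 in
/-- A bound for the oscillation of the error on a segment by the error on a parallelogram. -/
lemma abs_integral_err_le (hΩ : IsPolygonalLipschitzDomain Ω)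
    (h𝒯 : IsTriangulation Ω 𝒯 h) {U : Plane → ℝ} (hU : U ∈ feSpace 𝒯) {a g d : Plane}
    (hgd : cross g d ≠ 0) (hg : ‖g‖ ≤ 1) (hd : ‖d‖ ≤ 1) {ℓ : ℝ} (hℓ : 0 < ℓ)
    (hmem : ∀ s ∈ Set.Icc 0 ℓ, ∀ t ∈ Set.Icc 0 ℓ, a + s • g + t • d ∈ closure Ω)
    {c : ℝ} (hc : 0 < c) :
    |∫ s in Set.Icc 0 ℓ, err U (a + s • g) * (ℓ ^ 2 - 6 * ℓ * s + 6 * s ^ 2)| ≤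
      c * ℓ ^ 4 + ℓ ^ 2 / c * (|(cross g d)⁻¹| * ∫ x in Ω, ‖fderiv ℝ (err U) x‖ ^ 2) := by
  set Q : Set (ℝ × ℝ) := Set.Icc 0 ℓ ×ˢ Set.Icc 0 ℓ with hQ
  have hQc : IsCompact Q := isCompact_Icc.prod isCompact_Icc
  have hQm : ∀ z ∈ Q, param a g d z ∈ closure Ω := fun z hz => hmem _ hz.1 _ hz.2
  have hpm := (continuous_param a g d).measurable
  obtain ⟨hint, hle⟩ := integrableOn_param a hgd hQm
    ((measurable_fderiv_err U).norm.pow_const 2) (integrableOn_sq_norm_fderiv_err hΩ h𝒯 hU)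
    (fun x => by positivity)
  rw [← setIntegral_congr_set (ae_eq_closure hΩ)] at hle
  obtain ⟨b, hb⟩ := exists_norm_fderiv_err_le h𝒯 hU
  have hbd : ∀ᵐ z ∂volume.restrict Q, ‖fderiv ℝ (err U) (param a g d z)‖ ≤ b := by
    rw [ae_restrict_iff' (hQc.measurableSet)]
    filter_upwards [ae_param a hgd (ae_mem_interior_element h𝒯)] with z hz hzQ
    obtain ⟨T, hT, hzT⟩ := hz (hQm z hzQ)
    exact hb T hT _ hzT
  have hG : ∀ v : Plane, IntegrableOn (fun z => fderiv ℝ (err U) (param a g d z) v) Q := by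
    intro v
    refine IntegrableOn.of_bound hQc.measure_lt_top
      ((measurable_fderiv_apply_const ℝ (err U) v).comp hpm).aestronglyMeasurable (b * ‖v‖) ?_
    filter_upwards [hbd] with z hz
    exact (ContinuousLinearMap.le_opNorm _ _).trans (by gcongr)
  have hdg : cross d g ≠ 0 := by
    have : cross d g = -cross g d := by unfold cross; ring
    rw [this]; exact neg_ne_zero.mpr hgd
  -- Here `φ = s(ℓ - s)(ℓ - 2s)` vanishes on the lateral sides and `χ` on the far side, so the only
  -- boundary term is the one on the segment.
  have hgreen := green_square hℓ.le (F := fun z => err U (param a g d z))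
    (φ := fun s => ℓ ^ 2 * s - 3 * ℓ * s ^ 2 + 2 * s ^ 3)
    (φ' := fun s => ℓ ^ 2 - 6 * ℓ * s + 6 * s ^ 2) (χ := fun t => 1 - t / ℓ)
    (χ' := fun _ => -(1 / ℓ))
    ((continuousOn_err h𝒯 hU).comp (continuous_param a g d).continuousOn hQm) (hG g) (hG d)
    (by
      filter_upwards [ae_finite_line_frontier h𝒯 a hdg] with t ht htI
      have := exists_hasDerivAt_err_line h𝒯 hU (ℓ := ℓ) ht fun s hs => by
        rw [add_right_comm]; exact hmem s hs t htI
      simpa only [param, add_right_comm a] using this)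
    (by
      filter_upwards [ae_finite_line_frontier h𝒯 a hgd] with s hs hsI
      exact exists_hasDerivAt_err_line h𝒯 hU (ℓ := ℓ) hs fun t ht => hmem s hsI t ht)
    (by
      intro s
      have := (((hasDerivAt_id s).const_mul (ℓ ^ 2)).sub
        ((hasDerivAt_pow 2 s).const_mul (3 * ℓ))).add ((hasDerivAt_pow 3 s).const_mul 2)
      refine this.congr_deriv ?_
      norm_num
      ring)
    (by fun_prop)
    (by
      intro t
      have := ((hasDerivAt_id t).div_const ℓ).const_sub 1
      exact this)
    (by fun_prop) (by ring) (by ring) (by simp) (by simp [hℓ.ne'])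
  have hF0 : ∀ s : ℝ, err U (param a g d (s, 0)) = err U (a + s • g) := by
    intro s; simp [param]
  simp only [hF0] at hgreen
  rw [hgreen, ← Real.norm_eq_abs]
  have hpt : ∀ z ∈ Q, ‖fderiv ℝ (err U) (param a g d z) g *
      ((ℓ ^ 2 * z.1 - 3 * ℓ * z.1 ^ 2 + 2 * z.1 ^ 3) * -(1 / ℓ)) -
      fderiv ℝ (err U) (param a g d z) d *
      ((ℓ ^ 2 - 6 * ℓ * z.1 + 6 * z.1 ^ 2) * (1 - z.2 / ℓ))‖ ≤
      c * ℓ ^ 2 + ℓ ^ 2 / c * ‖fderiv ℝ (err U) (param a g d z)‖ ^ 2 := by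
    intro z hz
    have hN0 : 0 ≤ ‖fderiv ℝ (err U) (param a g d z)‖ := norm_nonneg _
    exact abs_green_integrand_le hℓ hc hz.1 hz.2
      (((fderiv ℝ (err U) (param a g d z)).le_opNorm g).trans (mul_le_of_le_one_right hN0 hg))
      (((fderiv ℝ (err U) (param a g d z)).le_opNorm d).trans (mul_le_of_le_one_right hN0 hd))
  have hQv : volume.real Q = ℓ ^ 2 := by
    rw [hQ, measureReal_def, Measure.volume_eq_prod, Measure.prod_prod, Real.volume_Icc, sub_zero,
      ENNReal.toReal_mul, ENNReal.toReal_ofReal hℓ.le]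
    ring
  have hconst : Integrable (fun _ : ℝ × ℝ => c * ℓ ^ 2) (volume.restrict Q) :=
    integrableOn_const hQc.measure_lt_top.ne
  calc _ ≤ ∫ z in Q, (c * ℓ ^ 2 + ℓ ^ 2 / c * ‖fderiv ℝ (err U) (param a g d z)‖ ^ 2) := by
        refine norm_integral_le_of_norm_le (hconst.add (hint.const_mul _)) ?_
        exact (ae_restrict_iff' hQc.measurableSet).mpr (Filter.Eventually.of_forall hpt)
    _ = c * ℓ ^ 4 + ℓ ^ 2 / c * ∫ z in Q, ‖fderiv ℝ (err U) (param a g d z)‖ ^ 2 := by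
        rw [integral_add hconst (hint.const_mul _),
          setIntegral_const, integral_const_mul, hQv, smul_eq_mul]
        ring
    _ ≤ _ := by gcongr

/-- If `U` is almost linear on a segment, its difference to a quadratic function is not small. -/
lemma le_integral_err {U : Plane → ℝ} {a g : Plane} (hg : ‖g‖ = 1) {ℓ m : ℝ} (hℓ : 0 < ℓ)
    (hc : ContinuousOn (fun s : ℝ => err U (a + s • g)) (Set.Icc 0 ℓ))
    (hU : ∀ s ∈ Set.Icc 0 ℓ, |U (a + s • g) - U a - m * s| ≤ ℓ / 60 * s) :
    ℓ ^ 5 / 60 ≤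
      ∫ s in Set.Icc 0 ℓ, err U (a + s • g) * (ℓ ^ 2 - 6 * ℓ * s + 6 * s ^ 2) := by
  set c₀ := ‖a‖ ^ 2 - U a
  set c₁ := 2 * inner ℝ a g - m
  -- The weight annihilates `c₀ + c₁ s`, and its integral against `s²` is `ℓ⁵/30`; half of this is
  -- reserved for the deviation of `U` from an affine function.
  have hP : ∫ s in Set.Icc 0 ℓ,
      ((c₀ + c₁ * s + s ^ 2) * (ℓ ^ 2 - 6 * ℓ * s + 6 * s ^ 2) - ℓ ^ 4 / 60) = ℓ ^ 5 / 60 := by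
    rw [integral_Icc_eq_integral_Ioc, ← intervalIntegral.integral_of_le hℓ.le,
      intervalIntegral.integral_eq_sub_of_hasDerivAt
        (f := fun s => c₀ * (ℓ ^ 2 * s - 3 * ℓ * s ^ 2 + 2 * s ^ 3) +
          c₁ * (ℓ ^ 2 / 2 * s ^ 2 - 2 * ℓ * s ^ 3 + 3 / 2 * s ^ 4) +
          (ℓ ^ 2 / 3 * s ^ 3 - 3 / 2 * ℓ * s ^ 4 + 6 / 5 * s ^ 5) - ℓ ^ 4 / 60 * s)]
    · ring
    · intro s _
      have p1 := hasDerivAt_id s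
      have p2 := hasDerivAt_pow 2 s
      have p3 := hasDerivAt_pow 3 s
      have p4 := hasDerivAt_pow 4 s
      have p5 := hasDerivAt_pow 5 s
      have := ((((((p1.const_mul (ℓ ^ 2)).sub (p2.const_mul (3 * ℓ))).add
        (p3.const_mul 2)).const_mul c₀).add ((((p2.const_mul (ℓ ^ 2 / 2)).sub
        (p3.const_mul (2 * ℓ))).add (p4.const_mul (3 / 2))).const_mul c₁)).add
        (((p3.const_mul (ℓ ^ 2 / 3)).sub (p4.const_mul (3 / 2 * ℓ))).add
        (p5.const_mul (6 / 5)))).sub (p1.const_mul (ℓ ^ 4 / 60))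
      refine this.congr_deriv ?_
      norm_num
      ring
    · exact Continuous.intervalIntegrable (by fun_prop) _ _
  rw [← hP]
  refine setIntegral_mono_on (Continuous.integrableOn_Icc (by fun_prop))
    ((hc.mul (by fun_prop)).integrableOn_compact isCompact_Icc) measurableSet_Icc ?_
  intro s hs
  have e1 : err U (a + s • g) = c₀ + c₁ * s + s ^ 2 - (U (a + s • g) - U a - m * s) := by
    simp only [err, quadFun_eq, c₀, c₁]
    rw [norm_add_sq_real, norm_smul, hg, inner_smul_right, mul_one, Real.norm_eq_abs, sq_abs]
    ring
  have e2 : |ℓ ^ 2 - 6 * ℓ * s + 6 * s ^ 2| ≤ ℓ ^ 2 :=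
    abs_le.mpr ⟨by nlinarith [sq_nonneg (ℓ - 2 * s)], by nlinarith [hs.1, hs.2]⟩
  have e3 : |U (a + s • g) - U a - m * s| ≤ ℓ / 60 * ℓ :=
    (hU s hs).trans (by have := hs.2; gcongr)
  have e4 : (U (a + s • g) - U a - m * s) * (ℓ ^ 2 - 6 * ℓ * s + 6 * s ^ 2) ≤ ℓ ^ 4 / 60 := by
    refine (le_abs_self _).trans ?_
    rw [abs_mul]
    calc _ ≤ ℓ / 60 * ℓ * ℓ ^ 2 := by gcongr
      _ = _ := by ring
  rw [e1, sub_mul]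
  linarith

/-- If `U` is almost linear on a segment in the closure of the domain, then the length of the
segment is bounded in terms of the error. -/
lemma exists_pow_length_le (hΩ : IsPolygonalLipschitzDomain Ω) :
    ∃ ρ C : ℝ, 0 < ρ ∧ 0 < C ∧ ∀ (𝒯 : Complex2) (h : ℝ), IsTriangulation Ω 𝒯 h →
      ∀ U ∈ feSpace 𝒯, ∀ (a g : Plane) (ℓ m : ℝ), ‖g‖ = 1 → 0 < ℓ → ℓ < ρ →
      (∀ s ∈ Set.Icc 0 ℓ, a + s • g ∈ closure Ω) →
      (∀ s ∈ Set.Icc 0 ℓ, |U (a + s • g) - U a - m * s| ≤ ℓ / 60 * s) →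
      ℓ ^ 4 ≤ C * ∫ x in Ω, ‖fderiv ℝ (err U) x‖ ^ 2 := by
  obtain ⟨ρ, κ, hρ, hκ, H⟩ := exists_uniform_cone hΩ
  refine ⟨ρ, 14400 / Real.sqrt κ, hρ, by positivity, ?_⟩
  intro 𝒯 h h𝒯 U hU a g ℓ m hg hℓ hℓρ hmem hlin
  obtain ⟨d, hd, hκd, hcone⟩ := H a (by simpa using hmem 0 ⟨le_rfl, hℓ.le⟩) g hg
  have hgd : cross g d ≠ 0 := by
    intro h0
    rw [h0] at hκd
    norm_num at hκd
    linarith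
  have hinv : |(cross g d)⁻¹| ≤ 1 / Real.sqrt κ := by
    rw [abs_inv, ← one_div]
    have : Real.sqrt κ ≤ |cross g d| := by
      rw [← Real.sqrt_sq_eq_abs]; exact Real.sqrt_le_sqrt hκd
    have := Real.sqrt_pos.mpr hκ
    gcongr
  have hmem' : ∀ s ∈ Set.Icc 0 ℓ, ∀ t ∈ Set.Icc 0 ℓ, a + s • g + t • d ∈ closure Ω := by
    intro s hs t ht
    rcases ht.1.eq_or_lt with h0 | h0
    · rw [← h0, zero_smul, add_zero]; exact hmem s hs
    · refine subset_closure (hcone _ (hmem s hs) ?_ t h0 (ht.2.trans_lt hℓρ))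
      rw [dist_eq_norm, add_sub_cancel_left, norm_smul, hg, mul_one, Real.norm_of_nonneg hs.1]
      exact hs.2.trans_lt hℓρ
  have hc : ContinuousOn (fun s : ℝ => err U (a + s • g)) (Set.Icc 0 ℓ) :=
    (continuousOn_err h𝒯 hU).comp (by fun_prop) hmem
  have h1 := le_integral_err hg hℓ hc hlin
  -- With `c = ℓ/120` the first term is `ℓ⁵/120`, half of the lower bound. What remains is `ℓ⁵/120 ≤
  -- 120 ℓ · (…)`, hence the constant `14400 = 120²`.
  have h2 := (le_abs_self _).trans
    (abs_integral_err_le hΩ h𝒯 hU hgd hg.le hd hℓ hmem' (c := ℓ / 120) (by positivity))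
  set E := ∫ x in Ω, ‖fderiv ℝ (err U) x‖ ^ 2
  have hE : 0 ≤ E := integral_nonneg fun x => by positivity
  have h3 : |(cross g d)⁻¹| * E ≤ 1 / Real.sqrt κ * E := by gcongr
  have h4 : ℓ ^ 2 / (ℓ / 120) = 120 * ℓ := by field_simp
  rw [h4] at h2
  have h5 : ℓ * ℓ ^ 4 ≤ ℓ * (14400 * (1 / Real.sqrt κ * E)) := by
    nlinarith [mul_le_mul_of_nonneg_left h3 hℓ.le]
  calc ℓ ^ 4 ≤ 14400 * (1 / Real.sqrt κ * E) := le_of_mul_le_mul_left h5 hℓ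
    _ = _ := by ring

end TraceEstimate

/-! ### Geometry of a band and the slopes of `U` along its edge -/

section BandGeometry

variable {𝒯 : Complex2} {Ω : Set Plane} {h : ℝ}

lemma ne_of_mem_elements {a b c : Plane} (hT : {a, b, c} ∈ elements 𝒯) :
    a ≠ b ∧ a ≠ c ∧ b ≠ c := by
  obtain ⟨s, -, hc, hs⟩ := hT
  have hcard : ({a, b, c} : Set Plane).ncard = 3 := by
    rw [hs, Set.ncard_coe_finset, hc]
  refine ⟨?_, ?_, ?_⟩ <;> rintro rfl
  · rw [Set.insert_eq_of_mem (Set.mem_insert a _)] at hcard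
    have := Set.ncard_insert_le a {c}
    rw [Set.ncard_singleton] at this
    omega
  · rw [Set.insert_eq_of_mem (by simp)] at hcard
    have := Set.ncard_insert_le b {a}
    rw [Set.ncard_singleton] at this
    omega
  · rw [Set.pair_eq_singleton] at hcard
    have := Set.ncard_insert_le a {b}
    rw [Set.ncard_singleton] at this
    omega

lemma notMem_line_of_mem_elements {a b c : Plane} (hT : {a, b, c} ∈ elements 𝒯) (t : ℝ) :
    c ≠ a + t • (b - a) := by
  obtain ⟨-, hac, hbc⟩ := ne_of_mem_elements hT
  have h1 := element_notMem_affineSpan hT (x := c) (by simp)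
  intro hc
  apply h1
  have h2 : AffineMap.lineMap a b t ∈ affineSpan ℝ (({a, b, c} : Set Plane) \ {c}) :=
    AffineMap.lineMap_mem _ (subset_affineSpan ℝ _ ⟨by simp, hac⟩)
      (subset_affineSpan ℝ _ ⟨by simp, hbc⟩)
  rw [AffineMap.lineMap_apply, vsub_eq_sub, vadd_eq_add, add_comm, ← hc] at h2
  exact h2

/-- Both gradients reproduce the same difference of `U` along a common edge. -/
lemma IsGradOn.inner_sub_eq_zero {U : Plane → ℝ} {T T' : Set Plane} {w w' x y : Plane}
    (hw : IsGradOn U T w) (hw' : IsGradOn U T' w') (hx : x ∈ T) (hy : y ∈ T) (hx' : x ∈ T')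
    (hy' : y ∈ T') : inner ℝ (w - w') (x - y) = 0 := by
  have h1 := hw x (subset_convexHull ℝ _ hx) y (subset_convexHull ℝ _ hy)
  have h2 := hw' x (subset_convexHull ℝ _ hx') y (subset_convexHull ℝ _ hy')
  rw [inner_sub_left, ← h1, ← h2, sub_self]

namespace Band

variable (B : Band 𝒯)

/-- The vertices of `K i`. -/
def K (i : ℕ) : Set Plane := {B.p i, B.p (i + 1), B.q i}

/-- The vertices of `K̃ (i+1)`. -/
def K' (i : ℕ) : Set Plane := {B.q i, B.q (i + 1), B.p (i + 1)}

/-- The position of `p i` on the edge `Γ` of the band. -/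
def pos (i : ℕ) : ℝ := ∑ j ∈ Finset.range i, dist (B.p j) (B.p (j + 1))

lemma pos_succ (i : ℕ) : B.pos (i + 1) = B.pos i + dist (B.p i) (B.p (i + 1)) :=
  Finset.sum_range_succ _ _

lemma pos_mono : Monotone B.pos :=
  monotone_nat_of_le_succ fun i => by
    rw [pos_succ]; linarith [dist_nonneg (x := B.p i) (y := B.p (i + 1))]

lemma pos_nonneg (i : ℕ) : 0 ≤ B.pos i := Finset.sum_nonneg fun _ _ => dist_nonneg

lemma dist_pos_of_le {i : ℕ} (hi : i ≤ B.N) : 0 < dist (B.p i) (B.p (i + 1)) :=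
  dist_pos.mpr (ne_of_mem_elements (B.elem_mem i hi)).1

lemma p_eq {i : ℕ} (hi : i ≤ B.N + 1) : B.p i = B.p 0 + B.pos i • B.g := by
  induction i with
  | zero => simp [pos]
  | succ i ih =>
    rw [B.straight i (by omega), ih (by omega), pos_succ, add_smul, add_assoc]
    congr 3
    rw [← ih (by omega)]

lemma pos_lt {i j : ℕ} (hij : i < j) (hi : i ≤ B.N) : B.pos i < B.pos j :=
  calc B.pos i < B.pos (i + 1) := by rw [pos_succ]; linarith [B.dist_pos_of_le hi]
    _ ≤ B.pos j := B.pos_mono hij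

lemma pos_injOn {i j : ℕ} (hi : i ≤ B.N + 1) (hj : j ≤ B.N + 1) (hp : B.p i = B.p j) :
    i = j := by
  have hg : B.g ≠ 0 := fun h0 => by simpa [h0] using B.norm_g
  rw [B.p_eq hi, B.p_eq hj, add_right_inj] at hp
  have := smul_left_injective ℝ hg hp
  rcases lt_trichotomy i j with h | h | h
  · exact absurd this (B.pos_lt h (by omega)).ne
  · exact h
  · exact absurd this (B.pos_lt h (by omega)).ne'

/-- All `p j` lie on the line of `Γ`, while `q i` is off it because `K i` is nondegenerate. -/
lemma q_ne_p {i j : ℕ} (hi : i ≤ B.N) (hj : j ≤ B.N + 1) : B.q i ≠ B.p j := by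
  have hd := B.dist_pos_of_le hi
  have := notMem_line_of_mem_elements (B.elem_mem i hi)
    ((B.pos j - B.pos i) / dist (B.p i) (B.p (i + 1)))
  intro hq
  apply this
  have hs := B.straight i hi
  have hs' : B.p (i + 1) - B.p i = dist (B.p i) (B.p (i + 1)) • B.g := by
    rw [sub_eq_iff_eq_add', ← hs]
  rw [hs', smul_smul, div_mul_cancel₀ _ hd.ne', hq, B.p_eq hj, B.p_eq (i := i) (by omega)]
  module

lemma length_eq_pos : B.length = B.pos (B.N + 1) := by
  rw [length, B.p_eq le_rfl, dist_eq_norm, sub_add_cancel_left, norm_neg, norm_smul, B.norm_g,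
    mul_one, Real.norm_of_nonneg (B.pos_nonneg _)]

lemma K_mem {i : ℕ} (hi : i ≤ B.N) : B.K i ∈ elements 𝒯 := B.elem_mem i hi

lemma K'_mem {i : ℕ} (hi : i < B.N) : B.K' i ∈ elements 𝒯 := B.elem'_mem i hi

lemma K_mem_elems {i : ℕ} (hi : i ≤ B.N) : B.K i ∈ B.elems := Or.inl ⟨i, hi, rfl⟩

lemma K'_mem_elems {i : ℕ} (hi : i < B.N) : B.K' i ∈ B.elems := Or.inr ⟨i, hi, rfl⟩

lemma K_inj {i j : ℕ} (hi : i ≤ B.N) (hj : j ≤ B.N) (hij : B.K i = B.K j) : i = j := by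
  -- The order matters: for `i < j` the point `p i` precedes both `p j` and `p (j + 1)`, whereas for
  -- `j < i` it could be `p (j + 1)`.
  suffices H : ∀ i j, i ≤ B.N → j ≤ B.N → B.K i = B.K j → ¬ i < j by
    exact le_antisymm (not_lt.mp (H j i hj hi hij.symm)) (not_lt.mp (H i j hi hj hij))
  intro i j hi hj hij hlt
  have hmem : B.p i ∈ B.K j := hij ▸ (Or.inl rfl : B.p i ∈ B.K i)
  rcases hmem with h | h | h
  · have := B.pos_injOn (by omega) (by omega) h; omega
  · have := B.pos_injOn (by omega) (by omega) h; omega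
  · exact B.q_ne_p hj (by omega) (Set.mem_singleton_iff.mp h).symm

lemma K'_inj {i j : ℕ} (hi : i < B.N) (hj : j < B.N) (hij : B.K' i = B.K' j) : i = j := by
  have hmem : B.p (i + 1) ∈ B.K' j :=
    hij ▸ (Or.inr (Or.inr rfl) : B.p (i + 1) ∈ B.K' i)
  rcases hmem with h | h | h
  · exact absurd h.symm (B.q_ne_p (by omega) (by omega))
  · exact absurd h.symm (B.q_ne_p (by omega) (by omega))
  · have := B.pos_injOn (by omega) (by omega) (Set.mem_singleton_iff.mp h); omega

lemma add_smul_mem {i : ℕ} (hi : i ≤ B.N) {s : ℝ} (h0 : B.pos i ≤ s) (h1 : s ≤ B.pos (i + 1)) :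
    B.p 0 + s • B.g ∈ convexHull ℝ (B.K i) := by
  have hd := B.dist_pos_of_le hi
  rw [pos_succ] at h1
  have hseg : B.p 0 + s • B.g ∈ segment ℝ (B.p i) (B.p (i + 1)) := by
    rw [segment_eq_image']
    refine ⟨(s - B.pos i) / dist (B.p i) (B.p (i + 1)),
      ⟨div_nonneg (by linarith) hd.le, (div_le_one hd).mpr (by linarith)⟩, ?_⟩
    have hs' : B.p (i + 1) - B.p i = dist (B.p i) (B.p (i + 1)) • B.g := by
      rw [sub_eq_iff_eq_add', ← B.straight i hi]
    simp only
    rw [hs', smul_smul, div_mul_cancel₀ _ hd.ne', B.p_eq (i := i) (by omega)]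
    module
  exact segment_subset_convexHull (by simp [K]) (by simp [K]) hseg

lemma exists_pos_le {s : ℝ} (h0 : 0 ≤ s) (h1 : s ≤ B.length) :
    ∃ i ≤ B.N, B.pos i ≤ s ∧ s ≤ B.pos (i + 1) := by
  rw [length_eq_pos] at h1
  have : ∀ n, s ≤ B.pos (n + 1) → ∃ i ≤ n, B.pos i ≤ s ∧ s ≤ B.pos (i + 1) := by
    intro n
    induction n with
    | zero => exact fun hs => ⟨0, le_rfl, by simpa [pos] using h0, hs⟩
    | succ n ih =>
      intro hs
      by_cases hn : s ≤ B.pos (n + 1)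
      · obtain ⟨i, hi, H⟩ := ih hn
        exact ⟨i, by omega, H⟩
      · exact ⟨n + 1, le_rfl, (not_le.mp hn).le, hs⟩
  exact this _ h1

lemma add_smul_mem_closure (h𝒯 : IsTriangulation Ω 𝒯 h) {s : ℝ} (h0 : 0 ≤ s)
    (h1 : s ≤ B.length) : B.p 0 + s • B.g ∈ closure Ω := by
  obtain ⟨i, hi, h2, h3⟩ := B.exists_pos_le h0 h1
  rw [← h𝒯.space_eq]
  exact elements_subset_space (B.K_mem hi) (B.add_smul_mem hi h2 h3)

/-- The jump of the derivative of `U` in the direction of the band between `K i` and `K (i+1)`,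
where `w` is the gradient of `U`. -/
def jump (w : Set Plane → Plane) (i : ℕ) : ℝ := inner ℝ (w (B.K (i + 1)) - w (B.K i)) B.g

/-- Every slope of `U` along `Γ` differs from the first one by at most the sum of all jumps; add up
over the pieces of `Γ`. -/
lemma abs_sub_linear_le {U : Plane → ℝ} {w : Set Plane → Plane}
    (hw : ∀ T ∈ elements 𝒯, IsGradOn U T (w T)) {s : ℝ} (h0 : 0 ≤ s) (h1 : s ≤ B.length) :
    |U (B.p 0 + s • B.g) - U (B.p 0) - inner ℝ (w (B.K 0)) B.g * s| ≤
      (∑ i ∈ Finset.range B.N, |B.jump w i|) * s := by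
  set ε := ∑ i ∈ Finset.range B.N, |B.jump w i|
  have hslope : ∀ i ≤ B.N, |inner ℝ (w (B.K i)) B.g - inner ℝ (w (B.K 0)) B.g| ≤ ε := by
    intro i hi
    have hsum : inner ℝ (w (B.K i)) B.g - inner ℝ (w (B.K 0)) B.g =
        ∑ j ∈ Finset.range i, B.jump w j := by
      rw [← Finset.sum_range_sub (fun j => inner ℝ (w (B.K j)) B.g)]
      exact Finset.sum_congr rfl fun j _ => by rw [jump, inner_sub_left]
    rw [hsum]
    exact (Finset.abs_sum_le_sum_abs _ _).trans (Finset.sum_le_sum_of_subset_of_nonneg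
      (Finset.range_mono hi) fun _ _ _ => abs_nonneg _)
  have hstep : ∀ i ≤ B.N, ∀ s, B.pos i ≤ s → s ≤ B.pos (i + 1) →
      |U (B.p i) - U (B.p 0) - inner ℝ (w (B.K 0)) B.g * B.pos i| ≤ ε * B.pos i →
      |U (B.p 0 + s • B.g) - U (B.p 0) - inner ℝ (w (B.K 0)) B.g * s| ≤ ε * s := by
    intro i hi s hs0 hs1 ih
    have hx := hw _ (B.K_mem hi) _ (B.add_smul_mem hi hs0 hs1) (B.p i)
      (subset_convexHull ℝ _ (Or.inl rfl))
    have hsub : B.p 0 + s • B.g - B.p i = (s - B.pos i) • B.g := by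
      rw [B.p_eq (i := i) (by omega)]; module
    rw [hsub, inner_smul_right] at hx
    have hsl := hslope i hi
    calc _ = |(U (B.p i) - U (B.p 0) - inner ℝ (w (B.K 0)) B.g * B.pos i) + (s - B.pos i) *
          (inner ℝ (w (B.K i)) B.g - inner ℝ (w (B.K 0)) B.g)| := by
          congr 1
          rw [sub_eq_iff_eq_add.mp hx]
          ring
      _ ≤ ε * B.pos i + (s - B.pos i) * ε := by
          refine (abs_add_le _ _).trans (add_le_add ih ?_)
          rw [abs_mul, abs_of_nonneg (sub_nonneg.mpr hs0)]
          gcongr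
      _ = _ := by ring
  have hvert : ∀ i ≤ B.N + 1,
      |U (B.p i) - U (B.p 0) - inner ℝ (w (B.K 0)) B.g * B.pos i| ≤ ε * B.pos i := by
    intro i
    induction i with
    | zero => intro _; simp [pos]
    | succ i ih =>
      intro hi
      have := hstep i (by omega) _ (B.pos_mono (Nat.le_succ i)) le_rfl (ih (by omega))
      rwa [← B.p_eq hi] at this
  obtain ⟨i, hi, h2, h3⟩ := B.exists_pos_le h0 h1
  exact hstep i hi s h2 h3 (hvert i (by omega))

lemma abs_jump_le {U : Plane → ℝ} {w : Set Plane → Plane}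
    (hw : ∀ T ∈ elements 𝒯, IsGradOn U T (w T)) {Cα : ℝ} {i : ℕ} (hi : i < B.N)
    (hα : Real.sin (Real.pi - B.ang i) ≤ Cα * Real.sin (Real.pi - B.ang' i)) :
    |B.jump w i| ≤ Real.sin (Real.pi - B.ang' i) * (Cα * ‖w (B.K' i) - w (B.K i)‖ +
      (1 + Cα) * ‖w (B.K' i) - w (B.K (i + 1))‖) := by
  have hKi := B.K_mem (i := i) (by omega)
  have hKi1 := B.K_mem (i := i + 1) (by omega)
  have hK' := B.K'_mem hi
  refine BandFEM.abs_jump_le B.norm_g (ne_of_mem_elements hKi).1 (B.straight i (by omega))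
    (ne_of_mem_elements hKi).2.2.symm (B.q_ne_p (i := i + 1) (by omega) (by omega)) ?_ ?_ ?_ ?_
  · exact (hw _ hK').inner_sub_eq_zero (hw _ hKi) (by simp [K']) (by simp [K']) (by simp [K])
      (by simp [K])
  · exact (hw _ hK').inner_sub_eq_zero (hw _ hKi1) (by simp [K']) (by simp [K']) (by simp [K])
      (by simp [K])
  · rw [B.maxAngle_eq' i hi, Real.sin_pi_sub]; rfl
  · refine (sin_angle_le_sin_maxAngle (ne_of_mem_elements hKi).1).trans ?_
    rw [← Real.sin_pi_sub]
    exact hα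

end Band

end BandGeometry

/-! ### The variation on long bands and the sum over disjoint bands -/

section Estimates

variable {𝒯 : Complex2} {Ω : Set Plane} {h : ℝ}

/-- An upper bound for the diameter of `Ω`. -/
def diamBound (Ω : Set Plane) : ℝ := max 1 (Metric.diam (closure Ω))

lemma one_le_diamBound (Ω : Set Plane) : 1 ≤ diamBound Ω := le_max_left _ _

lemma dist_le_diamBound (hΩ : IsPolygonalLipschitzDomain Ω) {x y : Plane} (hx : x ∈ closure Ω)
    (hy : y ∈ closure Ω) : dist x y ≤ diamBound Ω :=
  (Metric.dist_le_diam_of_mem hΩ.isBounded.closure hx hy).trans (le_max_right _ _)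

lemma meshSize_le_diamBound (hΩ : IsPolygonalLipschitzDomain Ω) (h𝒯 : IsTriangulation Ω 𝒯 h) :
    h ≤ diamBound Ω := by
  obtain ⟨T, hT, rfl⟩ := h𝒯.meshSize.1
  exact (Metric.diam_mono (h𝒯.space_eq ▸ elements_subset_space hT) hΩ.isBounded.closure).trans
    (le_max_right _ _)

lemma Band.length_le_diamBound (hΩ : IsPolygonalLipschitzDomain Ω) (h𝒯 : IsTriangulation Ω 𝒯 h)
    (B : Band 𝒯) : B.length ≤ diamBound Ω := by
  have hL : 0 ≤ B.length := dist_nonneg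
  have h0 := B.add_smul_mem_closure h𝒯 le_rfl hL
  have h1 := B.add_smul_mem_closure h𝒯 hL le_rfl
  rw [zero_smul, add_zero] at h0
  rw [B.length_eq_pos, ← B.p_eq le_rfl] at h1
  exact dist_le_diamBound hΩ h0 h1

lemma integral_le_of_h1Seminorm_le {U : Plane → ℝ} {m : ℝ}
    (hE : h1Seminorm Ω (err U) ≤ m) : ∫ x in Ω, ‖fderiv ℝ (err U) x‖ ^ 2 ≤ m ^ 2 :=
  (Real.sqrt_le_left ((Real.sqrt_nonneg _).trans hE)).mp hE

/-- On long bands, the derivative of `U` in the direction of the band has a large variation. -/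
lemma exists_le_sum_abs_jump (hΩ : IsPolygonalLipschitzDomain Ω) {α : ℝ}
    (hα : α ∈ Set.Icc (0 : ℝ) 1) {M : ℝ} (hM : 0 < M) :
    ∃ C_L c : ℝ, 0 < C_L ∧ 0 < c ∧ ∀ (𝒯 : Complex2) (h : ℝ), 0 < h → IsTriangulation Ω 𝒯 h →
      ∀ U ∈ feSpace 𝒯, h1Seminorm Ω (err U) ≤ M * h ^ α → ∀ w : Set Plane → Plane,
      (∀ T ∈ elements 𝒯, IsGradOn U T (w T)) → ∀ B : Band 𝒯,
      C_L * h ^ (2 * α / 5) ≤ B.length → c * B.length ≤ ∑ i : Fin B.N, |B.jump w i| := by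
  obtain ⟨ρ, C, hρ, hC, H⟩ := exists_pow_length_le hΩ
  obtain ⟨hα0, hα1⟩ := hα
  set D := diamBound Ω with hDdef
  have hD : 1 ≤ D := one_le_diamBound Ω
  have hD0 : 0 < D := by linarith
  -- Only the piece of length `σ L` of the band is used, which is shorter than `ρ` because `L ≤ D`.
  set σ := min 1 (ρ / (2 * D)) with hσdef
  have hσ : 0 < σ := lt_min one_pos (by positivity)
  -- Chosen so that `C_L = X + 1` satisfies `σ⁴ C_L⁴ > C M² D`, contradicting the bound on the
  -- fourth power of the length.
  set X := C * M ^ 2 * D / σ ^ 4 with hX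
  have hX0 : 0 < X := by positivity
  refine ⟨X + 1, σ / 60, by positivity, by positivity, ?_⟩
  intro 𝒯 h hh h𝒯 U hU hE w hw B hL
  have hrp : 0 < h ^ (2 * α / 5) := Real.rpow_pos_of_pos hh _
  have hL0 : 0 < B.length := lt_of_lt_of_le (by positivity) hL
  have hLD : B.length ≤ D := B.length_le_diamBound hΩ h𝒯
  by_contra! hlt
  rw [← Finset.sum_range (fun i => |B.jump w i|)] at hlt
  have hℓL : σ * B.length ≤ B.length := mul_le_of_le_one_left hL0.le (min_le_left _ _)
  have hℓρ : σ * B.length < ρ := by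
    calc σ * B.length ≤ ρ / (2 * D) * D := by
          gcongr
          exact min_le_right _ _
      _ = ρ / 2 := by field_simp
      _ < ρ := by linarith
  have key := H 𝒯 h h𝒯 U hU (B.p 0) B.g (σ * B.length) _ B.norm_g (by positivity) hℓρ
    (fun s hs => B.add_smul_mem_closure h𝒯 hs.1 (hs.2.trans hℓL))
    (fun s hs => (B.abs_sub_linear_le hw hs.1 (hs.2.trans hℓL)).trans
      (mul_le_mul_of_nonneg_right (hlt.le.trans_eq (by ring)) hs.1))
  have hE2 := integral_le_of_h1Seminorm_le hE
  -- The spare fifth factor is bounded by `D` below: the fourth-power bound needs no more than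
  -- `h^(α/2)`, and the exponent `2α/5` is weaker up to a constant.
  have hp1 : (h ^ (2 * α / 5)) ^ 4 * h ^ (2 * α / 5) = (h ^ α) ^ 2 := by
    rw [← Real.rpow_natCast, ← Real.rpow_natCast, ← Real.rpow_mul hh.le, ← Real.rpow_mul hh.le,
      ← Real.rpow_add hh]
    congr 1
    push_cast
    ring
  have hp2 : h ^ (2 * α / 5) ≤ D := by
    calc h ^ (2 * α / 5) ≤ D ^ (2 * α / 5) :=
          Real.rpow_le_rpow hh.le (meshSize_le_diamBound hΩ h𝒯) (by positivity)
      _ ≤ D ^ (1 : ℝ) := Real.rpow_le_rpow_of_exponent_le hD (by linarith)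
      _ = D := Real.rpow_one D
  set r := h ^ (2 * α / 5)
  have h1 : σ ^ 4 * ((X + 1) ^ 4 * r ^ 4) ≤ C * M ^ 2 * D * r ^ 4 :=
    calc σ ^ 4 * ((X + 1) ^ 4 * r ^ 4) = (σ * ((X + 1) * r)) ^ 4 := by ring
      _ ≤ (σ * B.length) ^ 4 := by gcongr
      _ ≤ C * (M * h ^ α) ^ 2 := key.trans (by gcongr)
      _ = C * M ^ 2 * r * r ^ 4 := by rw [mul_pow, ← hp1]; ring
      _ ≤ C * M ^ 2 * D * r ^ 4 := by gcongr
  have h2 : X < (X + 1) ^ 4 :=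
    calc X < X + 1 := lt_add_one X
      _ ≤ (X + 1) ^ 4 := le_self_pow₀ (by linarith) (by norm_num)
  have h3 : C * M ^ 2 * D = σ ^ 4 * X := by rw [hX]; field_simp
  rw [h3] at h1
  have h4 : σ ^ 4 * X * r ^ 4 < σ ^ 4 * ((X + 1) ^ 4 * r ^ 4) := by
    rw [mul_assoc]; gcongr
  linarith

/-- The integral which controls the error of the gradients on the elements. -/
def tau (U : Plane → ℝ) (h : ℝ) (s : Set Plane) : ℝ :=
  ∫ x in s, (2 * ‖fderiv ℝ (err U) x‖ ^ 2 + 8 * h ^ 2)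

lemma sum_tau_le {ι : Type*} [Fintype ι] (hΩ : IsPolygonalLipschitzDomain Ω)
    (h𝒯 : IsTriangulation Ω 𝒯 h) {U : Plane → ℝ} (hU : U ∈ feSpace 𝒯) {T : ι → Set Plane}
    (hT : ∀ i, T i ∈ elements 𝒯) (hinj : Function.Injective T) :
    ∑ i, tau U h (convexHull ℝ (T i)) ≤ tau U h Ω := by
  refine sum_setIntegral_le hΩ h𝒯 hT hinj ?_ fun x => by positivity
  exact (((integrableOn_sq_norm_fderiv_err hΩ h𝒯 hU).mono_set subset_closure).const_mul 2).add
    (integrableOn_const hΩ.isBounded.measure_lt_top.ne)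

/-- The term `8h²` is harmless: `α ≤ 1` and `h` is bounded by the diameter bound, so `h` is at most
a constant times `h ^ α`. -/
lemma tau_le (hΩ : IsPolygonalLipschitzDomain Ω) (h𝒯 : IsTriangulation Ω 𝒯 h) (hh : 0 < h)
    {U : Plane → ℝ} (hU : U ∈ feSpace 𝒯) {α M : ℝ} (hα : α ≤ 1)
    (hE : h1Seminorm Ω (err U) ≤ M * h ^ α) :
    tau U h Ω ≤ (2 * M ^ 2 + 8 * volume.real Ω * (diamBound Ω ^ (1 - α)) ^ 2) * (h ^ α) ^ 2 := by
  have hc : IntegrableOn (fun _ : Plane => 8 * h ^ 2) Ω :=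
    integrableOn_const hΩ.isBounded.measure_lt_top.ne
  have hi := ((integrableOn_sq_norm_fderiv_err hΩ h𝒯 hU).mono_set
    (subset_closure (s := Ω))).const_mul 2
  rw [tau, integral_add hi hc, setIntegral_const, integral_const_mul, smul_eq_mul]
  have h1 := integral_le_of_h1Seminorm_le hE
  have h2 : h ≤ diamBound Ω ^ (1 - α) * h ^ α := by
    calc h = h ^ (1 - α) * h ^ α := by
          rw [← Real.rpow_add hh, sub_add_cancel, Real.rpow_one]
      _ ≤ _ := by
          gcongr
          exact meshSize_le_diamBound hΩ h𝒯
  calc _ ≤ 2 * (M * h ^ α) ^ 2 +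
        volume.real Ω * (8 * (diamBound Ω ^ (1 - α) * h ^ α) ^ 2) := by gcongr
    _ = _ := by ring

namespace Band

variable (B : Band 𝒯)

lemma areaK_eq (i : ℕ) : B.areaK i = volume.real (convexHull ℝ (B.K i)) := rfl

lemma areaK'_eq (i : ℕ) : B.areaK' i = volume.real (convexHull ℝ (B.K' i)) := rfl

lemma areaK'_nonneg (i : ℕ) : 0 ≤ B.areaK' i := measureReal_nonneg

/-- The contribution of `K̃ (i+1)` to the weight of the band. -/
lemma area_mul_jump_sq_le (hΩ : IsPolygonalLipschitzDomain Ω) (h𝒯 : IsTriangulation Ω 𝒯 h)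
    {U : Plane → ℝ} (hU : U ∈ feSpace 𝒯) {w : Set Plane → Plane}
    (hw : ∀ T ∈ elements 𝒯, IsGradOn U T (w T)) {C_K Cα : ℝ} (hCα : 0 ≤ Cα) (hCK : 0 ≤ C_K)
    (hB : B.IsAdmissible C_K Cα) {i : ℕ} (hi : i < B.N) :
    1 / Real.sin (Real.pi - B.ang' i) ^ 2 * B.areaK' i * B.jump w i ^ 2 ≤
      12 * (1 + Cα) ^ 2 * (tau U h (convexHull ℝ (B.K' i)) +
        C_K * tau U h (convexHull ℝ (B.K i)) +
        C_K * tau U h (convexHull ℝ (B.K (i + 1)))) := by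
  obtain ⟨hB1, hB2, hB3⟩ := hB i hi
  have hj := B.abs_jump_le hw hi hB3
  set S := Real.sin (Real.pi - B.ang' i)
  -- The vertex common to the three triangles, so one value `2p` of `∇u` serves for all of them.
  set p := B.p (i + 1)
  have hKi := B.K_mem (i := i) (by omega)
  have hKi1 := B.K_mem (i := i + 1) (by omega)
  have hK' := B.K'_mem hi
  have t0 := area_mul_sq_le hΩ h𝒯 hU hKi (hw _ hKi) (p := p) (by simp [K, p])
  have t1 := area_mul_sq_le hΩ h𝒯 hU hKi1 (hw _ hKi1) (p := p) (by simp [K, p])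
  have t' := area_mul_sq_le hΩ h𝒯 hU hK' (hw _ hK') (p := p) (by simp [K', p])
  rw [← areaK_eq] at t0 t1
  rw [← areaK'_eq] at t'
  change _ ≤ tau U h _ at t0 t1 t'
  have n0 : ‖w (B.K' i) - w (B.K i)‖ ≤ ‖w (B.K' i) - (2 : ℝ) • p‖ + ‖w (B.K i) - (2 : ℝ) • p‖ := by
    rw [← sub_sub_sub_cancel_right _ _ ((2 : ℝ) • p)]; exact norm_sub_le _ _
  have n1 : ‖w (B.K' i) - w (B.K (i + 1))‖ ≤
      ‖w (B.K' i) - (2 : ℝ) • p‖ + ‖w (B.K (i + 1)) - (2 : ℝ) • p‖ := by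
    rw [← sub_sub_sub_cancel_right _ _ ((2 : ℝ) • p)]; exact norm_sub_le _ _
  set x := ‖w (B.K' i) - (2 : ℝ) • p‖
  set y := ‖w (B.K i) - (2 : ℝ) • p‖
  set z := ‖w (B.K (i + 1)) - (2 : ℝ) • p‖
  have hx : 0 ≤ x := norm_nonneg _
  have hy : 0 ≤ y := norm_nonneg _
  have hz : 0 ≤ z := norm_nonneg _
  have hA := B.areaK'_nonneg i
  set A := B.areaK' i
  set Y := Cα * ‖w (B.K' i) - w (B.K i)‖ + (1 + Cα) * ‖w (B.K' i) - w (B.K (i + 1))‖ with hY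
  have hY0 : 0 ≤ Y := by positivity
  have hYle : Y ≤ (1 + Cα) * (2 * x + y + z) := by
    calc Y ≤ (1 + Cα) * (x + y) + (1 + Cα) * (x + z) := by
          rw [hY]
          gcongr
          linarith
      _ = _ := by ring
  have hJ : 1 / S ^ 2 * B.jump w i ^ 2 ≤ Y ^ 2 := by
    have hJ2 : B.jump w i ^ 2 ≤ S ^ 2 * Y ^ 2 := by
      rw [← mul_pow, ← sq_abs]; gcongr
    -- For `S = 0` the convention `1 / 0 = 0` makes the claim trivial, so positivity of the sine
    -- need not be shown.
    rcases eq_or_ne S 0 with h0 | h0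
    · rw [h0]; simpa using sq_nonneg Y
    · rw [one_div, inv_mul_le_iff₀ (by positivity)]; exact hJ2
  have hY2 : Y ^ 2 ≤ 12 * (1 + Cα) ^ 2 * (x ^ 2 + y ^ 2 + z ^ 2) := by
    calc Y ^ 2 ≤ ((1 + Cα) * (2 * x + y + z)) ^ 2 := by gcongr
      _ = (1 + Cα) ^ 2 * (2 * x + y + z) ^ 2 := by ring
      _ ≤ (1 + Cα) ^ 2 * (12 * (x ^ 2 + y ^ 2 + z ^ 2)) := by
          gcongr
          nlinarith [sq_nonneg (2 * x - y), sq_nonneg (2 * x - z), sq_nonneg (y - z)]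
      _ = _ := by ring
  calc _ = A * (1 / S ^ 2 * B.jump w i ^ 2) := by ring
    _ ≤ A * (12 * (1 + Cα) ^ 2 * (x ^ 2 + y ^ 2 + z ^ 2)) := by
        exact mul_le_mul_of_nonneg_left (hJ.trans hY2) hA
    _ = 12 * (1 + Cα) ^ 2 * (A * x ^ 2 + A * y ^ 2 + A * z ^ 2) := by ring
    _ ≤ 12 * (1 + Cα) ^ 2 * (A * x ^ 2 + (C_K * B.areaK i) * y ^ 2 +
        (C_K * B.areaK (i + 1)) * z ^ 2) := by gcongr
    _ = 12 * (1 + Cα) ^ 2 * (A * x ^ 2 + C_K * (B.areaK i * y ^ 2) +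
        C_K * (B.areaK (i + 1) * z ^ 2)) := by ring
    _ ≤ _ := by gcongr

/-- Cauchy–Schwarz over the `N` jumps produces `L² / N`; the minima are then replaced by the
individual factors under the sum. -/
lemma weight_le {w : Set Plane → Plane} {c : ℝ} (hc : 0 < c)
    (hL : c * B.length ≤ ∑ i : Fin B.N, |B.jump w i|) :
    B.weight ≤ (c ^ 2)⁻¹ * ∑ i : Fin B.N,
      1 / Real.sin (Real.pi - B.ang' i) ^ 2 * B.areaK' i * B.jump w i ^ 2 := by
  have hN : (0 : ℝ) < B.N := by exact_mod_cast B.one_le_N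
  have hL0 : 0 ≤ B.length := dist_nonneg
  set m₁ := ⨅ i : Fin B.N, 1 / Real.sin (Real.pi - B.ang' i) ^ 2 with hm₁
  set m₂ := ⨅ i : Fin B.N, B.areaK' i with hm₂
  have h1 : 0 ≤ m₁ := Real.iInf_nonneg fun i => by positivity
  have h2 : 0 ≤ m₂ := Real.iInf_nonneg fun i => B.areaK'_nonneg i
  have h1' : ∀ i : Fin B.N, m₁ ≤ 1 / Real.sin (Real.pi - B.ang' i) ^ 2 := fun i =>
    ciInf_le (Set.finite_range _).bddBelow i
  have h2' : ∀ i : Fin B.N, m₂ ≤ B.areaK' i := fun i =>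
    ciInf_le (Set.finite_range _).bddBelow i
  have hcs : (∑ i : Fin B.N, |B.jump w i|) ^ 2 ≤ B.N * ∑ i : Fin B.N, B.jump w i ^ 2 := by
    have := sq_sum_le_card_mul_sum_sq (s := (Finset.univ : Finset (Fin B.N)))
      (f := fun i => |B.jump w i|)
    simpa only [Finset.card_univ, Fintype.card_fin, sq_abs] using this
  have hL2 : c ^ 2 * B.length ^ 2 ≤ B.N * ∑ i : Fin B.N, B.jump w i ^ 2 := by
    rw [← mul_pow]
    refine le_trans ?_ hcs
    gcongr
  have hL3 : B.length ^ 2 * (B.N : ℝ)⁻¹ ≤ (c ^ 2)⁻¹ * ∑ i : Fin B.N, B.jump w i ^ 2 := by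
    rw [← div_eq_mul_inv, div_le_iff₀ hN, mul_assoc, ← div_eq_inv_mul,
      le_div_iff₀ (by positivity)]
    linarith
  calc B.weight = m₁ * m₂ * (B.length ^ 2 * (B.N : ℝ)⁻¹) := by rw [weight]; ring
    _ ≤ m₁ * m₂ * ((c ^ 2)⁻¹ * ∑ i : Fin B.N, B.jump w i ^ 2) := by gcongr
    _ = (c ^ 2)⁻¹ * ∑ i : Fin B.N, m₁ * m₂ * B.jump w i ^ 2 := by
        rw [← Finset.mul_sum]; ring
    _ ≤ _ := by
        gcongr with i
        exacts [h1' i, h2' i]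

end Band

/-- The necessary condition for a single mesh. -/
lemma exists_sum_weight_le (hΩ : IsPolygonalLipschitzDomain Ω) {α : ℝ}
    (hα : α ∈ Set.Icc (0 : ℝ) 1) {M : ℝ} (hM : 0 < M) :
    ∃ C_L : ℝ, 0 < C_L ∧ ∀ C_K C_α : ℝ, 0 < C_K → 0 < C_α → ∃ C : ℝ, 0 < C ∧
      ∀ (𝒯 : Complex2) (h : ℝ), 0 < h → IsTriangulation Ω 𝒯 h →
      ∀ U ∈ feSpace 𝒯, h1Seminorm Ω (err U) ≤ M * h ^ α →
      ∀ (n : ℕ) (B : Fin n → Band 𝒯), DisjointBands B → (∀ b, (B b).IsAdmissible C_K C_α) →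
      (∀ b, C_L * h ^ (2 * α / 5) ≤ (B b).length) →
      Real.sqrt (∑ b, (B b).weight) ≤ C * h ^ α := by
  obtain ⟨C_L, c, hCL, hc, H⟩ := exists_le_sum_abs_jump hΩ hα hM
  refine ⟨C_L, hCL, fun C_K C_α hCK hCα => ?_⟩
  set R := 2 * M ^ 2 + 8 * volume.real Ω * (diamBound Ω ^ (1 - α)) ^ 2 with hR
  have hR0 : 0 < R := by positivity
  set X := (c ^ 2)⁻¹ * (12 * (1 + C_α) ^ 2 * (1 + 2 * C_K)) * R with hX
  have hX0 : 0 < X := by positivity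
  refine ⟨Real.sqrt X, Real.sqrt_pos.mpr hX0, ?_⟩
  intro 𝒯 h hh h𝒯 U hU hE n B hdisj hadm hL
  have hw' : ∀ T, ∃ w, T ∈ elements 𝒯 → IsGradOn U T w := fun T => by
    by_cases hT : T ∈ elements 𝒯
    · obtain ⟨w, hw⟩ := exists_isGradOn hU hT
      exact ⟨w, fun _ => hw⟩
    · exact ⟨0, fun h => absurd h hT⟩
  choose w hw using hw'
  have hcross : ∀ b b' : Fin n, ∀ T, T ∈ (B b).elems → T ∈ (B b').elems → b = b' := by
    intro b b' T hT hT'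
    by_contra hne
    exact Set.disjoint_left.mp (hdisj hne) hT hT'
  have hsum' : ∑ x : (Σ b, Fin (B b).N), tau U h (convexHull ℝ ((B x.1).K' x.2)) ≤ tau U h Ω := by
    refine sum_tau_le hΩ h𝒯 hU (T := fun x : (Σ b, Fin (B b).N) => (B x.1).K' x.2)
      (fun x => (B x.1).K'_mem x.2.2) ?_
    rintro ⟨b, i⟩ ⟨b', j⟩ hT
    obtain rfl := hcross b b' _ ((B b).K'_mem_elems i.2)
      (by simp only at hT; rw [hT]; exact (B b').K'_mem_elems j.2)
    exact congrArg _ (Fin.ext ((B b).K'_inj i.2 j.2 hT))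
  -- The left neighbours (`k = 0`) and the right neighbours (`k = 1`) are summed separately: a
  -- triangle may be both, but occurs once in each sum. This gives the factor `1 + 2 C_K`.
  have hsum : ∀ k ≤ 1, ∑ x : (Σ b, Fin (B b).N), tau U h (convexHull ℝ ((B x.1).K (x.2 + k))) ≤
      tau U h Ω := by
    intro k hk
    refine sum_tau_le hΩ h𝒯 hU (T := fun x : (Σ b, Fin (B b).N) => (B x.1).K (x.2 + k))
      (fun x => (B x.1).K_mem (by omega)) ?_
    rintro ⟨b, i, hi⟩ ⟨b', j, hj⟩ hT
    simp only at hT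
    obtain rfl := hcross b b' _ ((B b).K_mem_elems (i := i + k) (by omega))
      (by rw [hT]; exact (B b').K_mem_elems (by omega))
    obtain rfl : i = j := by
      have := (B b).K_inj (by omega) (by omega) hT
      omega
    rfl
  have hmain : ∑ b, (B b).weight ≤ X * (h ^ α) ^ 2 := by
    calc ∑ b, (B b).weight ≤ ∑ b, (c ^ 2)⁻¹ * ∑ i : Fin (B b).N,
          12 * (1 + C_α) ^ 2 * (tau U h (convexHull ℝ ((B b).K' i)) +
            C_K * tau U h (convexHull ℝ ((B b).K i)) +
            C_K * tau U h (convexHull ℝ ((B b).K (i + 1)))) := by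
          refine Finset.sum_le_sum fun b _ => ((B b).weight_le hc
            (H 𝒯 h hh h𝒯 U hU hE w hw (B b) (hL b))).trans ?_
          exact mul_le_mul_of_nonneg_left (Finset.sum_le_sum fun i _ =>
            (B b).area_mul_jump_sq_le hΩ h𝒯 hU hw hCα.le hCK.le (hadm b) i.2) (by positivity)
      _ = (c ^ 2)⁻¹ * (12 * (1 + C_α) ^ 2 *
          (∑ x : (Σ b, Fin (B b).N), tau U h (convexHull ℝ ((B x.1).K' x.2)) +
          C_K * ∑ x : (Σ b, Fin (B b).N), tau U h (convexHull ℝ ((B x.1).K (x.2 + 0))) +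
          C_K * ∑ x : (Σ b, Fin (B b).N), tau U h (convexHull ℝ ((B x.1).K (x.2 + 1))))) := by
          simp only [Fintype.sum_sigma, add_zero, ← Finset.mul_sum, Finset.sum_add_distrib]
      _ ≤ (c ^ 2)⁻¹ * (12 * (1 + C_α) ^ 2 *
          (tau U h Ω + C_K * tau U h Ω + C_K * tau U h Ω)) := by
          gcongr
          exacts [hsum 0 (by norm_num), hsum 1 le_rfl]
      _ = (c ^ 2)⁻¹ * (12 * (1 + C_α) ^ 2 * (1 + 2 * C_K)) * tau U h Ω := by ring
      _ ≤ (c ^ 2)⁻¹ * (12 * (1 + C_α) ^ 2 * (1 + 2 * C_K)) * (R * (h ^ α) ^ 2) := by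
          gcongr
          exact tau_le hΩ h𝒯 hh hU hα.2 hE
      _ = _ := by rw [hX]; ring
  calc Real.sqrt (∑ b, (B b).weight) ≤ Real.sqrt (X * (h ^ α) ^ 2) := Real.sqrt_le_sqrt hmain
    _ = Real.sqrt X * h ^ α := by
        rw [Real.sqrt_mul hX0.le, Real.sqrt_sq (Real.rpow_nonneg hh.le _)]

end Estimates

/-! ### Area and angles of isosceles triangles -/

section Isosceles

/-- The area of the reference triangle. -/
def refArea : ℝ :=
  volume.real (convexHull ℝ ({((1 : ℝ), (0 : ℝ)), ((0 : ℝ), (1 : ℝ)), ((0 : ℝ), (0 : ℝ))} : Set (ℝ × ℝ)))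

lemma refArea_pos : 0 < refArea := by
  have hfin : ({((1 : ℝ), (0 : ℝ)), ((0 : ℝ), (1 : ℝ)), ((0 : ℝ), (0 : ℝ))} : Set (ℝ × ℝ)).Finite :=
    Set.toFinite _
  have hsub : Set.Icc (0 : ℝ) (1 / 2) ×ˢ Set.Icc (0 : ℝ) (1 / 2) ⊆
      convexHull ℝ ({((1 : ℝ), (0 : ℝ)), ((0 : ℝ), (1 : ℝ)), ((0 : ℝ), (0 : ℝ))} : Set (ℝ × ℝ)) := by
    rintro ⟨s, t⟩ ⟨⟨hs0, hs1⟩, ⟨ht0, ht1⟩⟩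
    simp only at hs0 hs1 ht0 ht1
    have := (convex_convexHull ℝ ({((1 : ℝ), (0 : ℝ)), ((0 : ℝ), (1 : ℝ)), ((0 : ℝ), (0 : ℝ))} :
      Set (ℝ × ℝ))).sum_mem (t := Finset.univ) (w := ![s, t, 1 - s - t])
      (z := ![((1 : ℝ), (0 : ℝ)), ((0 : ℝ), (1 : ℝ)), ((0 : ℝ), (0 : ℝ))])
      (by
        intro i _
        fin_cases i <;> simp <;> linarith)
      (by simp [Fin.sum_univ_three])
      (by
        intro i _
        fin_cases i <;> exact subset_convexHull ℝ _ (by simp))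
    simpa [Fin.sum_univ_three] using this
  refine lt_of_lt_of_le ?_ (measureReal_mono hsub (hfin.isCompact_convexHull ℝ).measure_lt_top.ne)
  rw [measureReal_def, Measure.volume_eq_prod, Measure.prod_prod, Real.volume_Icc,
    ← ENNReal.ofReal_mul (by norm_num), ENNReal.toReal_ofReal (by norm_num)]
  norm_num

lemma param_injective (a : Plane) {g d : Plane} (hgd : cross g d ≠ 0) :
    Function.Injective (param a g d) := by
  rintro ⟨s, t⟩ ⟨s', t'⟩ hz
  simp only [param, add_assoc, add_right_inj] at hz
  have h0 := congrArg (fun x : Plane => x 0) hz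
  have h1 := congrArg (fun x : Plane => x 1) hz
  simp only [PiLp.add_apply, PiLp.smul_apply, smul_eq_mul] at h0 h1
  have hs : (s - s') * cross g d = 0 := by
    unfold cross; linear_combination d 1 * h0 - d 0 * h1
  have ht : (t - t') * cross g d = 0 := by
    unfold cross; linear_combination g 0 * h1 - g 1 * h0
  rw [mul_eq_zero, or_iff_left hgd, sub_eq_zero] at hs ht
  rw [hs, ht]

/-- The triangle is an affine image of the reference triangle. Of the reference area only positivity
is needed later. -/
lemma area_eq {a b c : Plane} (hc : cross (a - c) (b - c) ≠ 0) :
    area a b c = refArea * |cross (a - c) (b - c)| := by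
  set x := a - c with hx
  set y := b - c with hy
  let f : ℝ × ℝ →ᵃ[ℝ] Plane := ((LinearMap.fst ℝ ℝ ℝ).smulRight x +
    (LinearMap.snd ℝ ℝ ℝ).smulRight y).toAffineMap + AffineMap.const ℝ (ℝ × ℝ) c
  have hf : ∀ z, f z = param c x y z := fun z => by
    simp only [f, AffineMap.coe_add, LinearMap.coe_toAffineMap, AffineMap.coe_const, Pi.add_apply,
      LinearMap.add_apply, LinearMap.smulRight_apply, LinearMap.fst_apply, LinearMap.snd_apply,
      Function.const_apply, param]
    abel
  set s : Set (ℝ × ℝ) := {((1 : ℝ), (0 : ℝ)), ((0 : ℝ), (1 : ℝ)), ((0 : ℝ), (0 : ℝ))} with hs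
  have himg : param c x y '' convexHull ℝ s = convexHull ℝ {a, b, c} := by
    rw [← funext hf, AffineMap.image_convexHull]
    congr 1
    simp only [hs, Set.image_insert_eq, Set.image_singleton, hf, param, hx, hy]
    simp
  have hcm : MeasurableSet (convexHull ℝ {a, b, c}) :=
    ((Set.toFinite {a, b, c}).isCompact_convexHull ℝ).measurableSet
  have hpre : param c x y ⁻¹' convexHull ℝ {a, b, c} = convexHull ℝ s := by
    rw [← himg, (param_injective c hc).preimage_image]
  have hm := congrArg (fun μ => μ.real (convexHull ℝ {a, b, c})) (map_param c hc)
  rw [map_measureReal_apply (continuous_param c x y).measurable hcm, hpre,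
    measureReal_ennreal_smul_apply, ENNReal.toReal_ofReal (abs_nonneg _), abs_inv] at hm
  have hc0 : 0 < |cross x y| := abs_pos.mpr hc
  rw [area, refArea, ← hs, hm]
  field_simp

lemma IsIsosceles.norm_sq {a b c : Plane} {h hbar : ℝ} (hi : IsIsosceles a b c h hbar) :
    ‖a - c‖ ^ 2 = h ^ 2 / 4 + hbar ^ 2 ∧ ‖b - c‖ ^ 2 = h ^ 2 / 4 + hbar ^ 2 ∧
      inner ℝ (a - c) (b - c) = hbar ^ 2 - h ^ 2 / 4 := by
  obtain ⟨h1, h2, h3⟩ := hi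
  rw [dist_eq_norm] at h1 h3
  rw [dist_eq_norm, dist_eq_norm] at h2
  have e1 : a - b = (a - c) - (b - c) := by abel
  have e3 : midpoint ℝ a b - c = (1 / 2 : ℝ) • ((a - c) + (b - c)) := by
    rw [midpoint_eq_smul_add, invOf_eq_inv]; module
  have k1 : h ^ 2 = ‖a - c‖ ^ 2 - 2 * inner ℝ (a - c) (b - c) + ‖b - c‖ ^ 2 := by
    rw [← h1, e1, norm_sub_sq_real]
  have k3 : hbar ^ 2 = 1 / 4 * (‖a - c‖ ^ 2 + 2 * inner ℝ (a - c) (b - c) + ‖b - c‖ ^ 2) := by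
    rw [← h3, e3, norm_smul, mul_pow, norm_add_sq_real]; norm_num
  rw [h2] at *
  refine ⟨?_, ?_, ?_⟩ <;> linarith

lemma IsIsosceles.cross_sq {a b c : Plane} {h hbar : ℝ} (hi : IsIsosceles a b c h hbar) :
    cross (a - c) (b - c) ^ 2 = (h * hbar) ^ 2 := by
  obtain ⟨h1, h2, h3⟩ := hi.norm_sq
  rw [BandFEM.cross_sq, h1, h2, h3]
  ring

lemma IsIsosceles.area_eq {a b c : Plane} {h hbar : ℝ} (hi : IsIsosceles a b c h hbar)
    (hh : 0 < h) (hb : 0 < hbar) : area a b c = refArea * (h * hbar) := by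
  have h1 : |cross (a - c) (b - c)| = h * hbar := by
    rw [← abs_of_pos (mul_pos hh hb)]; exact sq_eq_sq_iff_abs_eq_abs _ _ |>.mp hi.cross_sq
  rw [BandFEM.area_eq, h1]
  exact abs_pos.mp (h1 ▸ mul_pos hh hb)

/-- Twice the area, computed once from the legs and the apex angle and once from base and height. -/
lemma IsIsosceles.sin_angle_mul {a b c : Plane} {h hbar : ℝ} (hi : IsIsosceles a b c h hbar)
    (hh : 0 < h) (hb : 0 < hbar) :
    Real.sin (EuclideanGeometry.angle a c b) * (h ^ 2 / 4 + hbar ^ 2) = h * hbar := by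
  obtain ⟨h1, h2, h3⟩ := hi.norm_sq
  have := InnerProductGeometry.sin_angle_mul_norm_mul_norm (a - c) (b - c)
  have hn : ‖a - c‖ = ‖b - c‖ := by
    rw [← dist_eq_norm, ← dist_eq_norm]; exact hi.2.1
  rw [real_inner_self_eq_norm_sq, real_inner_self_eq_norm_sq, h1, h2, h3, hn, ← sq, h2] at this
  rw [EuclideanGeometry.angle, vsub_eq_sub, vsub_eq_sub, this, Real.sqrt_eq_iff_mul_self_eq
    (by nlinarith [sq_nonneg (h * hbar)]) (by positivity)]
  ring

lemma angle_eq_of_dist_eq {a b c a' b' c' : Plane} (hab : dist a b = dist a' b')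
    (hac : dist a c = dist a' c') (hbc : dist b c = dist b' c') :
    EuclideanGeometry.angle a b c = EuclideanGeometry.angle a' b' c' := by
  exact EuclideanGeometry.angle_eq_of_congruent (EuclideanGeometry.side_side_side hab hbc
    (by rw [dist_comm, hac, dist_comm])) 0 1 2

lemma IsIsosceles.maxAngle_eq {a b c a' b' c' : Plane} {h hbar : ℝ}
    (hi : IsIsosceles a b c h hbar) (hi' : IsIsosceles a' b' c' h hbar) :
    maxAngle a b c = maxAngle a' b' c' := by
  have hab : dist a b = dist a' b' := hi.1.trans hi'.1.symm
  have hac : dist a c = dist a' c' := by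
    rw [dist_eq_norm, dist_eq_norm, ← sq_eq_sq₀ (norm_nonneg _) (norm_nonneg _), hi.norm_sq.1,
      hi'.norm_sq.1]
  have hbc : dist b c = dist b' c' := by rw [← hi.2.1, ← hi'.2.1, hac]
  unfold maxAngle
  rw [angle_eq_of_dist_eq (a := b) (b := a) (c := c) (a' := b') (b' := a') (c' := c')
      (by rw [dist_comm, hab, dist_comm]) hbc hac,
    angle_eq_of_dist_eq hab hac hbc,
    angle_eq_of_dist_eq (a := a) (b := c) (c := b) (a' := a') (b' := c') (c' := b')
      hac hab (by rw [dist_comm, hbc, dist_comm])]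

end Isosceles

/-! ### Babuška–Aziz type bands -/

section BabuskaAziz

variable {𝒯 : Complex2} {n : ℕ} {B : Fin n → Band 𝒯} {h hbar L : ℝ}

lemma IsBabuskaAziz.isAdmissible (hB : IsBabuskaAziz B h hbar L) (hh : 0 < h) (hb : 0 < hbar)
    (b : Fin n) : (B b).IsAdmissible 1 1 := by
  intro i hi
  have e0 := hB.isosceles b i (by omega)
  have e1 := hB.isosceles b (i + 1) (by omega)
  have e' := hB.isosceles' b i hi
  refine ⟨?_, ?_, ?_⟩
  · rw [Band.areaK', Band.areaK, e'.area_eq hh hb, e1.area_eq hh hb, one_mul]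
  · rw [Band.areaK', Band.areaK, e'.area_eq hh hb, e0.area_eq hh hb, one_mul]
  · rw [Band.ang, Band.ang', e0.maxAngle_eq e', one_mul]

lemma IsBabuskaAziz.length_eq_mul (hB : IsBabuskaAziz B h hbar L) (b : Fin n) :
    L = ((B b).N + 1) * h := by
  rw [← hB.length_eq b, Band.length_eq_pos, Band.pos,
    Finset.sum_congr rfl fun i hi => (hB.isosceles b i (by simp at hi; omega)).1]
  simp

/-- The sine of the apex angle is at most `4 hbar / h`, the area is a multiple of `h hbar`, and `1 /
N ≥ h / L` because `L = (N + 1) h`. -/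
lemma IsBabuskaAziz.le_weight (hB : IsBabuskaAziz B h hbar L) (hh : 0 < h) (hb : 0 < hbar)
    (b : Fin n) : refArea / 16 * h ^ 4 * L / hbar ≤ (B b).weight := by
  have hN : (0 : ℝ) < (B b).N := by exact_mod_cast (B b).one_le_N
  have : Nonempty (Fin (B b).N) := ⟨⟨0, (B b).one_le_N⟩⟩
  have hr := refArea_pos
  have hL := hB.length_eq_mul b
  have hL0 : 0 < L := by rw [hL]; positivity
  have hm₁ : h ^ 2 / (16 * hbar ^ 2) ≤
      ⨅ i : Fin (B b).N, 1 / Real.sin (Real.pi - (B b).ang' i) ^ 2 := by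
    refine le_ciInf fun i => ?_
    have hs := (hB.isosceles' b i i.2).sin_angle_mul hh hb
    rw [(B b).maxAngle_eq' i i.2] at hs
    change Real.sin ((B b).ang' i) * _ = _ at hs
    rw [Real.sin_pi_sub]
    set S := Real.sin ((B b).ang' i)
    have hS : 0 < S := pos_of_mul_pos_left (hs ▸ mul_pos hh hb) (by positivity)
    have hle : S * h ≤ 4 * hbar := by
      have : S * h * h ≤ 4 * hbar * h := by nlinarith [mul_nonneg hS.le (sq_nonneg hbar)]
      exact le_of_mul_le_mul_right this hh
    rw [div_le_div_iff₀ (by positivity) (by positivity)]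
    calc h ^ 2 * S ^ 2 = (S * h) ^ 2 := by ring
      _ ≤ (4 * hbar) ^ 2 := by gcongr
      _ = _ := by ring
  have hm₂ : refArea * (h * hbar) ≤ ⨅ i : Fin (B b).N, (B b).areaK' i :=
    le_ciInf fun i => ((hB.isosceles' b i i.2).area_eq hh hb).ge
  have hm₃ : L * h ≤ L ^ 2 * ((B b).N : ℝ)⁻¹ := by
    rw [← div_eq_mul_inv, le_div_iff₀ hN, sq, mul_assoc]
    gcongr
    rw [hL]
    nlinarith
  calc refArea / 16 * h ^ 4 * L / hbar =
        h ^ 2 / (16 * hbar ^ 2) * (refArea * (h * hbar)) * (L * h) := by field_simp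
    _ ≤ (⨅ i : Fin (B b).N, 1 / Real.sin (Real.pi - (B b).ang' i) ^ 2) *
        (⨅ i : Fin (B b).N, (B b).areaK' i) * (L ^ 2 * ((B b).N : ℝ)⁻¹) := by
        have k₁ := le_trans (by positivity) hm₁
        have k₂ := le_trans (by positivity) hm₂
        gcongr
    _ = _ := by rw [Band.weight, hB.length_eq b]; ring

lemma IsBabuskaAziz.le_height (hB : IsBabuskaAziz B h hbar L) (hh : 0 < h) (hb : 0 < hbar)
    {α C : ℝ} (hC : 0 < C) (hw : Real.sqrt (∑ b, (B b).weight) ≤ C * h ^ α) :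
    Real.sqrt refArea / (4 * C) * h ^ (2 - α) * L ≤ hbar := by
  have hr := refArea_pos
  have hL0 : 0 ≤ L := by rw [← hB.count]; positivity
  have hα : 0 < h ^ α := Real.rpow_pos_of_pos hh α
  -- One of the two factors `L` in the square is `n * hbar`, so the square is `n` times the lower
  -- bound for one band.
  have h1 : (Real.sqrt refArea / 4 * h ^ 2 * L / hbar) ^ 2 ≤ ∑ b, (B b).weight := by
    calc (Real.sqrt refArea / 4 * h ^ 2 * L / hbar) ^ 2
        = n • (refArea / 16 * h ^ 4 * L / hbar) := by
          rw [nsmul_eq_mul, div_pow, mul_pow, mul_pow, div_pow, Real.sq_sqrt hr.le]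
          nth_rewrite 1 [sq L]
          nth_rewrite 1 [← hB.count]
          field_simp
          ring
      _ = ∑ b : Fin n, refArea / 16 * h ^ 4 * L / hbar := by simp
      _ ≤ _ := Finset.sum_le_sum fun b _ => hB.le_weight hh hb b
  have h3 : Real.sqrt refArea / 4 * h ^ 2 * L / hbar ≤ C * h ^ α :=
    (Real.le_sqrt_of_sq_le h1).trans hw
  rw [div_le_iff₀ hb] at h3
  have h4 : h ^ 2 = h ^ (2 - α) * h ^ α := by
    rw [← Real.rpow_add hh, sub_add_cancel]; norm_num
  rw [h4] at h3
  have h5 : (Real.sqrt refArea / (4 * C) * h ^ (2 - α) * L) * (C * h ^ α) ≤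
      hbar * (C * h ^ α) := by
    calc _ = Real.sqrt refArea / 4 * (h ^ (2 - α) * h ^ α) * L := by field_simp
      _ ≤ _ := by linarith
  exact le_of_mul_le_mul_right h5 (by positivity)

end BabuskaAziz

end BandFEM

end

theorem corollary2p2 (Ω : Set BandFEM.Plane) (hΩ : BandFEM.IsPolygonalLipschitzDomain Ω)
    (α : ℝ) (hα : α ∈ Set.Icc (0 : ℝ) 1) (M : ℝ) (hM : 0 < M) :
    ∃ C_L : ℝ, 0 < C_L ∧
      -- the necessary condition for general sets of bands
      (∀ C_K C_α : ℝ, 0 < C_K → 0 < C_α → ∃ C : ℝ, 0 < C ∧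
        ∀ (H : Set ℝ) (𝒯 : ℝ → BandFEM.Complex2),
          BandFEM.IsTriangulationFamily Ω H 𝒯 → BandFEM.ErrorEstimate Ω H 𝒯 α M →
          ∀ h ∈ H, ∀ (n : ℕ) (B : Fin n → BandFEM.Band (𝒯 h)),
            BandFEM.DisjointBands B →
            (∀ b, (B b).IsAdmissible C_K C_α) →
            (∀ b, C_L * h ^ (2 * α / 5) ≤ (B b).length) →
            Real.sqrt (∑ b, (B b).weight) ≤ C * h ^ α) ∧
      -- Babuška–Aziz type sets of bands
      (∃ c : ℝ, 0 < c ∧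
        ∀ (H : Set ℝ) (𝒯 : ℝ → BandFEM.Complex2),
          BandFEM.IsTriangulationFamily Ω H 𝒯 → BandFEM.ErrorEstimate Ω H 𝒯 α M →
          ∀ h ∈ H, ∀ (n : ℕ) (B : Fin n → BandFEM.Band (𝒯 h)) (hbar L : ℝ),
            BandFEM.IsBabuskaAziz B h hbar L →
            C_L * h ^ (2 * α / 5) ≤ L →
            c * h ^ (2 - α) * L ≤ hbar) ∧
      -- Babuška–Aziz type sets of bands whose length is bounded below
      (0 < α → ∀ ℓ : ℝ, 0 < ℓ → ∃ c h₁ : ℝ, 0 < c ∧ 0 < h₁ ∧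
        ∀ (H : Set ℝ) (𝒯 : ℝ → BandFEM.Complex2),
          BandFEM.IsTriangulationFamily Ω H 𝒯 → BandFEM.ErrorEstimate Ω H 𝒯 α M →
          ∀ h ∈ H, h < h₁ → ∀ (n : ℕ) (B : Fin n → BandFEM.Band (𝒯 h)) (hbar L : ℝ),
            BandFEM.IsBabuskaAziz B h hbar L →
            ℓ ≤ L →
            c * h ^ (2 - α) ≤ hbar) := by
  obtain ⟨C_L, hCL, H⟩ := BandFEM.exists_sum_weight_le hΩ hα hM
  have hBA : ∃ c : ℝ, 0 < c ∧
      ∀ (H : Set ℝ) (𝒯 : ℝ → BandFEM.Complex2),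
        BandFEM.IsTriangulationFamily Ω H 𝒯 → BandFEM.ErrorEstimate Ω H 𝒯 α M →
        ∀ h ∈ H, ∀ (n : ℕ) (B : Fin n → BandFEM.Band (𝒯 h)) (hbar L : ℝ),
          BandFEM.IsBabuskaAziz B h hbar L →
          C_L * h ^ (2 * α / 5) ≤ L →
          c * h ^ (2 - α) * L ≤ hbar := by
    obtain ⟨C, hC, hw⟩ := H 1 1 one_pos one_pos
    refine ⟨Real.sqrt BandFEM.refArea / (4 * C),
      div_pos (Real.sqrt_pos.mpr BandFEM.refArea_pos) (by positivity), ?_⟩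
    rintro S 𝒯 h𝒯 ⟨U, hU⟩ h hS n B hbar L hB hL
    obtain ⟨hh, hT⟩ := h𝒯 h hS
    have hb : 0 < hbar := by
      have hL0 : 0 < L := lt_of_lt_of_le (mul_pos hCL (Real.rpow_pos_of_pos hh _)) hL
      rw [← hB.count] at hL0
      exact pos_of_mul_pos_right hL0 n.cast_nonneg
    exact hB.le_height hh hb hC (hw (𝒯 h) h hh hT (U h) (hU h hS).1 (hU h hS).2 n B hB.disjoint
      (hB.isAdmissible hh hb) fun b => by rw [hB.length_eq b]; exact hL)
  refine ⟨C_L, hCL, fun C_K C_α hCK hCα => ?_, hBA, fun hα0 ℓ hℓ => ?_⟩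
  · obtain ⟨C, hC, hw⟩ := H C_K C_α hCK hCα
    refine ⟨C, hC, ?_⟩
    rintro S 𝒯 h𝒯 ⟨U, hU⟩ h hS n B hdisj hadm hL
    obtain ⟨hh, hT⟩ := h𝒯 h hS
    exact hw (𝒯 h) h hh hT (U h) (hU h hS).1 (hU h hS).2 n B hdisj hadm hL
  · obtain ⟨c, hc, hBA⟩ := hBA
    have hp : 0 < 2 * α / 5 := by positivity
    -- The threshold solves `C_L h^(2α/5) = ℓ`, which requires `α > 0`.
    refine ⟨c * ℓ, (ℓ / C_L) ^ (2 * α / 5)⁻¹, by positivity,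
      Real.rpow_pos_of_pos (by positivity) _, ?_⟩
    intro S 𝒯 h𝒯 hE h hS hlt n B hbar L hB hL
    have hh := (h𝒯 h hS).1
    have hCh : C_L * h ^ (2 * α / 5) ≤ ℓ := by
      rw [← le_div_iff₀' hCL]
      exact (Real.le_rpow_inv_iff_of_pos hh.le (by positivity) hp).mp hlt.le
    refine le_trans ?_ (hBA S 𝒯 h𝒯 hE h hS n B hbar L hB (hCh.trans hL))
    have := Real.rpow_pos_of_pos hh (2 - α)
    calc c * ℓ * h ^ (2 - α) = c * h ^ (2 - α) * ℓ := by ring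
      _ ≤ _ := by gcongr
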